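/- Let $\mathbb{K}$ be a field and let $V, V'$ be vector spaces over $\mathbb{K}$ of finite positive dimension. Definitions. An eigenspace of $A\in\mathrm{End}(V)$ is a nonzero subspace of the form $\{v\in V : Av=\theta v\}$, $\theta\in\mathbb{K}$; $A$ is diagonalizable if $V$ is spanned by its eigenspaces. For $A,A^*\in\mathrm{End}(V)$, an ordering $V_0,\dots,V_d$ of the eigenspaces of $A$ is standard if $A^*V_i\subseteq V_{i-1}+V_i+V_{i+1}$ for $0\le i\le d$ (with $V_{-1}=V_{d+1}=0$); standard orderings $V^*_0,\dots,V^*_\delta$ of the eigenspaces of $A^*$ are defined in the same way with $A$ and $A^*$ exchanged. The pair $A,A^*$ is a tridiagonal pair on $V$ if $A$ and $A^*$ are diagonalizable, each has a standard ordering of its eigenspaces, and no subspace $W\ne 0,V$ satisfies $AW\subseteq W$ and $A^*W\subseteq W$. It is known that then $d=\delta$ (the diameter) and $\dim V_i=\dim V^*_i=:\rho_i$ for $0\le i\le d$; the pair is sharp if $\rho_0=1$. A tridiagonal system on $V$ is a sequence $\Phi=(A;\{E_i\}_{i=0}^d;A^*;\{E^*_i\}_{i=0}^d)$ where $A,A^*$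 is a tridiagonal pair and, for some standard orderings $\{V_i\}_{i=0}^d$, $\{V^*_i\}_{i=0}^d$ of the eigenspaces of $A$, $A^*$, the map $E_i$ (resp. $E^*_i$) is the projection onto $V_i$ (resp. $V^*_i$) that vanishes on all $V_j$ (resp. $V^*_j$) with $j\ne i$; it is said to be associated with the pair $A,A^*$, and it is sharp if this pair is. If $\Phi$ is sharp, let $\theta_i$ (resp. $\theta^*_i$) be the eigenvalue of $A$ on $E_iV$ (resp. of $A^*$ on $E^*_iV$), let $U_i=(E^*_0V+\cdots+E^*_iV)\cap(E_iV+\cdots+E_dV)$, and let $\zeta_i$ be the eigenvalue of $$(A^*-\theta^*_1I)(A^*-\theta^*_2I)\cdots(A^*-\theta^*_iI)(A-\theta_{i-1}I)\cdots(A-\theta_1I)(A-\theta_0I)$$ on the one-dimensional space $U_0$, which is invariant under this map. The parameter array of $\Phi$ is $(\{\theta_i\}_{i=0}^d;\{\theta^*_i\}_{i=0}^d;\{\zeta_i\}_{i=0}^d)$; it is defined only when $\Phi$ is sharp. A parameter array of a tridiagonal pair is the parameter array of a tridiagonal system associated with it. Tridiagonal pairs $A,A^*$ on $V$ and $A',A^{*\prime}$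 on $V'$ are isomorphic if there is a linear bijection $\gamma:V\to V'$ with $\gamma A=A'\gamma$ and $\gamma A^*=A^{*\prime}\gamma$; tridiagonal systems are isomorphic if they have the same diameter $d$ and there is such a $\gamma$ which moreover satisfies $\gamma E_i=E'_i\gamma$ and $\gamma E^*_i=E^{*\prime}_i\gamma$ for $0\le i\le d$. Theorem. (i) A sharp tridiagonal pair on $V$ and a sharp tridiagonal pair on $V'$ are isomorphic if and only if they have a parameter array in common. (ii) Assume that $\mathbb{K}$ is algebraically closed. Then a tridiagonal pair on $V$ and a tridiagonal pair on $V'$ (not assumed to be sharp) are isomorphic if and only if they have a parameter array in common. (iii) Assume that $\mathbb{K}$ is algebraically closed. Then a tridiagonal system on $V$ and a tridiagonal system on $V'$ (not assumed to be sharp) are isomorphic if and only if they have the same parameter array. -/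

import Mathlib

open Module

namespace Tridiagonal

section Pairs

variable {K : Type*} [Field K] {V : Type*} [AddCommGroup V] [Module K V]
variable {V' : Type*} [AddCommGroup V'] [Module K V']

/-- `W` is an eigenspace of `A`: `W ≠ 0` and `W = {v | A v = θ v}` for some scalar `θ`. -/
def IsEigenspace (A : End K V) (W : Submodule K V) : Prop :=
  W ≠ ⊥ ∧ ∃ θ : K, W = A.eigenspace θ

/-- `A` is diagonalizable: `V` is spanned by the eigenspaces of `A`. -/
def IsDiagonalizable (A : End K V) : Prop :=
  sSup {W : Submodule K V | IsEigenspace A W} = ⊤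

/-- `W 0, …, W d` is an ordering of the eigenspaces of `A` (each listed exactly once) which is
standard with respect to `B`: one has `B (W i) ⊆ W (i-1) + W i + W (i+1)` for `0 ≤ i ≤ d`, where
`W (-1) = 0 = W (d+1)`. -/
structure IsStandardOrdering (A B : End K V) {d : ℕ} (W : Fin (d + 1) → Submodule K V) :
    Prop where
  injective : Function.Injective W
  range_eq : Set.range W = {U : Submodule K V | IsEigenspace A U}
  tridiagonal : ∀ i, (W i).map B ≤
    ⨆ j : Fin (d + 1), ⨆ _ : (j : ℕ) ≤ (i : ℕ) + 1 ∧ (i : ℕ) ≤ (j : ℕ) + 1, W j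

/-- `A, B` (with `B` in the role of `A^*`) is a tridiagonal pair on `V`. -/
structure IsTridiagonalPair (A B : End K V) : Prop where
  diagonalizable_left : IsDiagonalizable A
  diagonalizable_right : IsDiagonalizable B
  exists_ordering_left : ∃ (d : ℕ) (W : Fin (d + 1) → Submodule K V), IsStandardOrdering A B W
  exists_ordering_right : ∃ (δ : ℕ) (W : Fin (δ + 1) → Submodule K V), IsStandardOrdering B A W
  irreducible : ∀ W : Submodule K V, W.map A ≤ W → W.map B ≤ W → W = ⊥ ∨ W = ⊤

/-- `ρ 0, …, ρ d` is the shape of the tridiagonal pair `A, B`: for standard orderings `W i` and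
`W' i` of the eigenspaces of `A` and `B`, `ρ i` is the common dimension of `W i` and `W' i`. -/
def IsShape (A B : End K V) {d : ℕ} (ρ : Fin (d + 1) → ℕ) : Prop :=
  ∃ W W' : Fin (d + 1) → Submodule K V, IsStandardOrdering A B W ∧ IsStandardOrdering B A W' ∧
    ∀ i, finrank K (W i) = ρ i ∧ finrank K (W' i) = ρ i

/-- The tridiagonal pair `A, B` is sharp: its shape satisfies `ρ 0 = 1`. -/
def IsSharp (A B : End K V) : Prop :=
  ∃ (d : ℕ) (ρ : Fin (d + 1) → ℕ), IsShape A B ρ ∧ ρ 0 = 1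

/-- Isomorphism of the pairs `A, B` on `V` and `A', B'` on `V'`. -/
def PairIsomorphic (A B : End K V) (A' B' : End K V') : Prop :=
  ∃ γ : V ≃ₗ[K] V', (∀ v, γ (A v) = A' (γ v)) ∧ (∀ v, γ (B v) = B' (γ v))

/-- `E 0, …, E d` is a standard ordering of the primitive idempotents of `A` (with respect to
`B`): for a standard ordering `W 0, …, W d` of the eigenspaces of `A`, the map `E i` is the
identity on `W i` and zero on `W j` for `j ≠ i`. -/
def IsStandardIdempotents (A B : End K V) {d : ℕ} (E : Fin (d + 1) → End K V) : Prop :=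
  ∃ W : Fin (d + 1) → Submodule K V, IsStandardOrdering A B W ∧
    (∀ i, ∀ v ∈ W i, E i v = v) ∧ (∀ i j, j ≠ i → ∀ v ∈ W j, E i v = 0)

end Pairs

/-- A tridiagonal system `(A; {E i}; A^*; {E^* i})` of diameter `d` on `V`. -/
structure TridiagonalSystem (K : Type*) [Field K] (V : Type*) [AddCommGroup V] [Module K V]
    (d : ℕ) where
  A : End K V
  E : Fin (d + 1) → End K V
  As : End K V
  Es : Fin (d + 1) → End K V
  isTridiagonalPair : IsTridiagonalPair A As
  standard : IsStandardIdempotents A As E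
  standard_star : IsStandardIdempotents As A Es

/-- A sequence of scalars `({θ i}; {θ^* i}; {ζ i})`, each indexed by `0 ≤ i ≤ d`. -/
structure ParameterArray (K : Type*) (d : ℕ) where
  θ : Fin (d + 1) → K
  θs : Fin (d + 1) → K
  ζ : Fin (d + 1) → K

namespace TridiagonalSystem

variable {K : Type*} [Field K] {V : Type*} [AddCommGroup V] [Module K V] {d : ℕ}
variable {V' : Type*} [AddCommGroup V'] [Module K V'] {d' : ℕ}

/-- Isomorphism of tridiagonal systems (in particular the diameters agree). -/
def Isomorphic (Φ : TridiagonalSystem K V d) (Φ' : TridiagonalSystem K V' d') : Prop :=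
  d = d' ∧ ∃ γ : V ≃ₗ[K] V',
    (∀ v, γ (Φ.A v) = Φ'.A (γ v)) ∧ (∀ v, γ (Φ.As v) = Φ'.As (γ v)) ∧
    ∀ (i : Fin (d + 1)) (j : Fin (d' + 1)), (i : ℕ) = (j : ℕ) →
      (∀ v, γ (Φ.E i v) = Φ'.E j (γ v)) ∧ (∀ v, γ (Φ.Es i v) = Φ'.Es j (γ v))

/-- The `i`-th component of the split decomposition:
`U i = (E^*_0 V + ⋯ + E^*_i V) ∩ (E_i V + ⋯ + E_d V)`. -/
def splitSpace (Φ : TridiagonalSystem K V d) (i : Fin (d + 1)) : Submodule K V :=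
  (⨆ j : Fin (d + 1), ⨆ _ : j ≤ i, LinearMap.range (Φ.Es j)) ⊓
    (⨆ j : Fin (d + 1), ⨆ _ : i ≤ j, LinearMap.range (Φ.E j))

open Polynomial in
/-- The map `(A^* - θ^*_1) ⋯ (A^* - θ^*_i) (A - θ_{i-1}) ⋯ (A - θ_0)`. Each of the two groups of
factors is a polynomial in `A^*`, respectively `A`, so the order within a group is immaterial. -/
noncomputable def upDown (Φ : TridiagonalSystem K V d) (θ θs : Fin (d + 1) → K)
    (i : Fin (d + 1)) : End K V :=
  aeval Φ.As (∏ j ∈ Finset.Ioc 0 i, (X - C (θs j))) *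
    aeval Φ.A (∏ j ∈ Finset.Iio i, (X - C (θ j)))

/-- `p` is the parameter array of `Φ`. It is defined only when `Φ` is sharp; `θ i` and `θ^* i` are
the eigenvalues of `A` and `A^*` associated with `E i V` and `E^* i V`, and `ζ i` is the eigenvalue
of `upDown` on the (one-dimensional) space `U 0`. -/
structure IsParameterArray (Φ : TridiagonalSystem K V d) (p : ParameterArray K d) : Prop where
  sharp : IsSharp Φ.A Φ.As
  eigenvalue : ∀ i, LinearMap.range (Φ.E i) = Φ.A.eigenspace (p.θ i)
  eigenvalue_star : ∀ i, LinearMap.range (Φ.Es i) = Φ.As.eigenspace (p.θs i)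
  split : ∀ i, ∀ u ∈ Φ.splitSpace 0, Φ.upDown p.θ p.θs i u = p.ζ i • u

/-- `Φ` and `Φ'` have the same parameter array (in particular the diameters agree). -/
def SameParameterArray (Φ : TridiagonalSystem K V d) (Φ' : TridiagonalSystem K V' d') : Prop :=
  ∃ (h : d = d') (p : ParameterArray K d), Φ.IsParameterArray p ∧ Φ'.IsParameterArray (h ▸ p)

end TridiagonalSystem

section PairParameterArrays

variable {K : Type*} [Field K] {V : Type*} [AddCommGroup V] [Module K V]

/-- `p` is a parameter array of the pair `A, B`: it is the parameter array of an associated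
tridiagonal system. -/
def IsPairParameterArray (A B : End K V) {d : ℕ} (p : ParameterArray K d) : Prop :=
  ∃ Φ : TridiagonalSystem K V d, Φ.A = A ∧ Φ.As = B ∧ Φ.IsParameterArray p

/-- The pairs `A, B` and `A', B'` have a parameter array in common. -/
def HaveCommonParameterArray {V' : Type*} [AddCommGroup V'] [Module K V']
    (A B : End K V) (A' B' : End K V') : Prop :=
  ∃ (d : ℕ) (p : ParameterArray K d), IsPairParameterArray A B p ∧ IsPairParameterArray A' B' p

end PairParameterArrays

end Tridiagonal

/-!
Let `e` be the projection onto the eigenspace `E^*_0V` and `T` the algebra generated by `A` and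
`A^*`. Since `A` and `A^*` act tridiagonally on the eigenspaces of each other, a word
`e f₁(A) f₂(A^*) f₃(A) ⋯ e` can be shortened by interpolating its letters on the band of eigenvalues
that it can reach. It follows that the elements `e f(A) e` commute and generate the corner `e T e`.

If `K` is algebraically closed, `E^*_0V` is a simple module of this finitely generated commutative
algebra, hence a line. In general, if `E^*_0V` is a line, then `e` times
`(A - θ_{i-1}) ⋯ (A - θ_0)` acts on it as the scalar `ζ_i / ((θ^*_0 - θ^*_1) ⋯ (θ^*_0 - θ^*_i))`, so
the parameter array determines the action of `e T e`. Given two pairs with the same parameter array,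
let `v` and `v'` span `E^*_0V` and `E^*'_0V'`: each element of the corner acts on `v` and `v'` by
one and the same scalar, so by irreducibility the submodule of `V × V'` generated by `(v, v')` meets
neither factor nontrivially, and it is the graph of an isomorphism.
-/

namespace Tridiagonal

open Polynomial

section Interpolation

variable {K : Type*} [Field K] {d : ℕ}

theorem card_filter_val_mem_Ico_le (a b : ℕ) :
    (Finset.univ.filter fun i : Fin (d + 1) => (i : ℕ) ∈ Finset.Ico a b).card ≤ b - a :=
  (Finset.card_le_card_of_injOn (t := Finset.Ico a b) Fin.val (fun i hi => by simpa using hi)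
    Fin.val_injective.injOn).trans_eq (Nat.card_Ico a b)

theorem exists_degree_lt_eval_eq {θ : Fin (d + 1) → K} (hθ : Function.Injective θ) (g : K[X])
    (a b : ℕ) : ∃ q : K[X], q.degree < (b - a : ℕ) ∧
      ∀ i : Fin (d + 1), (i : ℕ) ∈ Finset.Ico a b → q.eval (θ i) = g.eval (θ i) := by
  refine ⟨Lagrange.interpolate {i : Fin (d + 1) | (i : ℕ) ∈ Finset.Ico a b} θ
    fun i => g.eval (θ i), ?_, fun i hi => ?_⟩
  · exact (Lagrange.degree_interpolate_lt _ hθ.injOn).trans_le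
      (by exact_mod_cast card_filter_val_mem_Ico_le a b)
  · exact Lagrange.eval_interpolate_at_node (fun i => g.eval (θ i)) hθ.injOn (by simpa using hi)

variable {N : Type*} [AddCommGroup N] [Module K N] (S : Submodule K N)

theorem mem_of_moments_mem {ι : Type*} [Fintype ι] {θ : ι → K} (hθ : Function.Injective θ)
    {x : ι → N} {J : Finset ι} {r : ℕ} (hJ : J.card ≤ r) (hx : ∀ i ∉ J, x i ∈ S)
    (hmom : ∀ f : K[X], f.degree < r → ∑ i, f.eval (θ i) • x i ∈ S) (i : ι) : x i ∈ S := by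
  classical
  by_cases hi : i ∈ J
  · have hdeg : (Lagrange.basis J θ i).degree < r := by
      have : 0 < J.card := Finset.card_pos.2 ⟨i, hi⟩
      rw [Lagrange.degree_basis hθ.injOn hi]
      exact_mod_cast (by omega : J.card - 1 < r)
    have h := hmom _ hdeg
    rw [← Finset.add_sum_erase _ _ (Finset.mem_univ i),
      Lagrange.eval_basis_self hθ.injOn hi, one_smul] at h
    refine (S.add_mem_iff_left (S.sum_mem fun j hj => ?_)).1 h
    by_cases hjJ : j ∈ J
    · rw [Lagrange.eval_basis_of_ne (Finset.ne_of_mem_erase hj).symm hjJ, zero_smul]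
      exact S.zero_mem
    · exact S.smul_mem _ (hx j hjJ)
  · exact hx i hi

theorem mem_of_mem_off_Ico_of_moments_mem {θ : Fin (d + 1) → K} (hθ : Function.Injective θ)
    {x : Fin (d + 1) → N} {a b : ℕ} (hx : ∀ i : Fin (d + 1), (i : ℕ) < a ∨ b ≤ i → x i ∈ S)
    (hmom : ∀ f : K[X], f.degree < (b - a : ℕ) → ∑ i, f.eval (θ i) • x i ∈ S)
    (i : Fin (d + 1)) : x i ∈ S := by
  refine mem_of_moments_mem S hθ (card_filter_val_mem_Ico_le a b) (fun i hi => hx i ?_) hmom i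
  simpa only [Finset.mem_filter, Finset.mem_univ, true_and, Finset.mem_Ico, not_and_or, not_le,
    not_lt] using hi

theorem band_mem_of_moments_mem {θ : Fin (d + 1) → K} (hθ : Function.Injective θ)
    {β : Fin (d + 1) → Fin (d + 1) → N} {m : ℕ}
    (hband : ∀ i j : Fin (d + 1), (i : ℕ) + m < j ∨ (j : ℕ) + m < i → β i j ∈ S)
    (hcol : ∀ f : K[X], f.degree < (m + 1 : ℕ) → ∀ j, ∑ i, f.eval (θ i) • β i j ∈ S)
    (hrow : ∀ f : K[X], f.degree < m → ∀ i, ∑ j, f.eval (θ j) • β i j ∈ S)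
    (i j : Fin (d + 1)) : β i j ∈ S := by
  suffices H : ∀ k : ℕ, ∀ k' : Fin (d + 1), (k' : ℕ) = k →
      (∀ i, β i k' ∈ S) ∧ ∀ j, β k' j ∈ S from (H _ j rfl).1 i
  intro k
  induction k using Nat.strong_induction_on with
  | _ k ih =>
    rintro k' rfl
    have column : ∀ i, β i k' ∈ S := by
      refine mem_of_mem_off_Ico_of_moments_mem S hθ (a := k') (b := k' + m + 1) (fun i hi => ?_)
        fun f hf => hcol f (by rwa [show (k' : ℕ) + m + 1 - k' = m + 1 by omega] at hf) k'
      exact hi.elim (fun hi => (ih i hi i rfl).2 k') fun hi => hband i k' (Or.inr hi)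
    refine ⟨column, mem_of_mem_off_Ico_of_moments_mem S hθ (a := k' + 1) (b := k' + m + 1)
      (fun j hj => ?_) fun f hf => hrow f (by
        rwa [show (k' : ℕ) + m + 1 - (k' + 1) = m by omega] at hf) k'⟩
    rcases hj with hj | hj
    · rcases Nat.lt_succ_iff_lt_or_eq.1 hj with hj | hj
      · exact (ih j hj j rfl).1 k'
      · exact Fin.ext hj ▸ column j
    · exact hband k' j (Or.inl hj)

theorem band_mem_of_moments_mem_of_antisymm {θ : Fin (d + 1) → K} (hθ : Function.Injective θ)
    {β : Fin (d + 1) → Fin (d + 1) → N} {m : ℕ} (hdiag : ∀ i, β i i ∈ S)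
    (hanti : ∀ i j, β i j + β j i ∈ S)
    (hband : ∀ i j : Fin (d + 1), (j : ℕ) + m < i → β i j ∈ S)
    (hcol : ∀ f : K[X], f.degree < m → ∀ j, ∑ i, f.eval (θ i) • β i j ∈ S)
    (i j : Fin (d + 1)) : β i j ∈ S := by
  suffices H : ∀ k : ℕ, ∀ k' : Fin (d + 1), (k' : ℕ) = k → ∀ i, β i k' ∈ S from H _ j rfl i
  intro k
  induction k using Nat.strong_induction_on with
  | _ k ih =>
    rintro k' rfl
    refine mem_of_mem_off_Ico_of_moments_mem S hθ (a := k' + 1) (b := k' + m + 1) (fun i hi => ?_)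
      fun f hf => hcol f (by rwa [show (k' : ℕ) + m + 1 - (k' + 1) = m by omega] at hf) k'
    rcases hi with hi | hi
    · rcases Nat.lt_succ_iff_lt_or_eq.1 hi with hi | hi
      · exact (S.add_mem_iff_left (ih i hi i rfl k')).1 (hanti i k')
      · exact Fin.ext hi ▸ hdiag i
    · exact hband i k' hi

end Interpolation

section LagrangeIdempotents

variable {K : Type*} [Field K] {R : Type*} [Ring R] [Algebra K R]

/-- The Lagrange idempotent of `a` at the node `θ i`: the projection onto the `θ i`-eigenspace
along the eigenspaces at the other nodes, if the nodes are distinct and `a` is annihilated by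
`∏ i, (X - θ i)`. -/
noncomputable def idem {ι : Type*} [Fintype ι] [DecidableEq ι] (a : R) (θ : ι → K) (i : ι) : R :=
  aeval a (Lagrange.basis Finset.univ θ i)

/-- `a` is diagonalizable with eigenvalues among the pairwise distinct scalars `θ i`. -/
structure IsDiagonalizableWith {ι : Type*} [Fintype ι] (a : R) (θ : ι → K) : Prop where
  injective : Function.Injective θ
  aeval_nodal : aeval a (Lagrange.nodal Finset.univ θ) = 0

namespace IsDiagonalizableWith

variable {ι : Type*} [Fintype ι] {a : R} {θ : ι → K}

theorem aeval_eq_of_eval_eq (h : IsDiagonalizableWith a θ) {f g : K[X]}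
    (hfg : ∀ i, f.eval (θ i) = g.eval (θ i)) : aeval a f = aeval a g := by
  have hdvd : Lagrange.nodal Finset.univ θ ∣ f - g := by
    rw [Lagrange.nodal_eq]
    refine Finset.prod_dvd_of_coprime (fun i _ j _ hij =>
      pairwise_coprime_X_sub_C h.injective hij) fun i _ => ?_
    rw [dvd_iff_isRoot, IsRoot.def, eval_sub, hfg, sub_self]
  obtain ⟨q, hq⟩ := hdvd
  rw [← sub_eq_zero, ← map_sub, hq, map_mul, h.aeval_nodal, zero_mul]

variable [DecidableEq ι]

theorem aeval_mul_idem (h : IsDiagonalizableWith a θ) (f : K[X]) (i : ι) :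
    aeval a f * idem a θ i = f.eval (θ i) • idem a θ i := by
  rw [idem, ← map_mul, ← map_smul]
  refine h.aeval_eq_of_eval_eq fun j => ?_
  by_cases hij : i = j
  · simp [hij]
  · simp [Lagrange.eval_basis_of_ne hij (Finset.mem_univ j)]

theorem idem_mul_aeval (h : IsDiagonalizableWith a θ) (f : K[X]) (i : ι) :
    idem a θ i * aeval a f = f.eval (θ i) • idem a θ i := by
  rw [← h.aeval_mul_idem, idem, ← map_mul, ← map_mul, mul_comm]

theorem idem_mul_self (h : IsDiagonalizableWith a θ) (i : ι) :
    idem a θ i * idem a θ i = idem a θ i := by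
  conv_lhs => enter [1]; rw [idem]
  rw [h.aeval_mul_idem, Lagrange.eval_basis_self h.injective.injOn (Finset.mem_univ i), one_smul]

theorem idem_mul_idem_of_ne (h : IsDiagonalizableWith a θ) {i j : ι} (hij : i ≠ j) :
    idem a θ i * idem a θ j = 0 := by
  conv_lhs => enter [1]; rw [idem]
  rw [h.aeval_mul_idem, Lagrange.eval_basis_of_ne hij (Finset.mem_univ j), zero_smul]

theorem sum_idem (h : IsDiagonalizableWith a θ) : ∑ i, idem a θ i = 1 := by
  simp only [idem]
  rw [← map_sum, ← map_one (aeval (R := K) a)]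
  refine h.aeval_eq_of_eval_eq fun i => ?_
  rw [eval_finsetSum, Finset.sum_eq_single i, Lagrange.eval_basis_self h.injective.injOn
    (Finset.mem_univ i), eval_one]
  · exact fun j _ hj => Lagrange.eval_basis_of_ne hj (Finset.mem_univ i)
  · exact fun hi => (hi (Finset.mem_univ i)).elim

theorem aeval_eq_sum (h : IsDiagonalizableWith a θ) (f : K[X]) :
    aeval a f = ∑ i, f.eval (θ i) • idem a θ i := by
  rw [← mul_one (aeval a f), ← h.sum_idem, Finset.mul_sum]
  exact Finset.sum_congr rfl fun i _ => h.aeval_mul_idem f i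

end IsDiagonalizableWith

/-- `a` is diagonalizable with eigenvalues among the distinct scalars `θ i`, and `b` acts
tridiagonally on the eigenspaces of `a` in the order given by the index. -/
structure IsTridiagonalOn {d : ℕ} (a b : R) (θ : Fin (d + 1) → K) : Prop
    extends IsDiagonalizableWith a θ where
  tri : ∀ i j : Fin (d + 1), (i : ℕ) + 1 < j ∨ (j : ℕ) + 1 < i →
    idem a θ i * b * idem a θ j = 0

namespace IsTridiagonalOn

variable {d : ℕ} {a b : R} {θ : Fin (d + 1) → K}

theorem idem_mul_pow_mul_idem (h : IsTridiagonalOn a b θ) (k : ℕ) {i j : Fin (d + 1)}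
    (hij : (i : ℕ) + k < j ∨ (j : ℕ) + k < i) : idem a θ i * b ^ k * idem a θ j = 0 := by
  induction k generalizing i with
  | zero =>
    rw [pow_zero, mul_one]
    exact h.idem_mul_idem_of_ne (Fin.val_injective.ne_iff.1 (by omega))
  | succ k ih =>
    calc idem a θ i * b ^ (k + 1) * idem a θ j
        = idem a θ i * b * (∑ l, idem a θ l) * (b ^ k * idem a θ j) := by
          rw [h.sum_idem, mul_one, pow_succ', mul_assoc, mul_assoc, mul_assoc]
      _ = ∑ l, idem a θ i * b * idem a θ l * (b ^ k * idem a θ j) := by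
          rw [Finset.mul_sum, Finset.sum_mul]
      _ = 0 := Finset.sum_eq_zero fun l _ => by
          by_cases hl : (l : ℕ) + k < j ∨ (j : ℕ) + k < l
          · rw [mul_assoc, ← mul_assoc (idem a θ l), ih hl, mul_zero]
          · rw [h.tri i l (by omega), zero_mul]

theorem idem_mul_aeval_mul_idem (h : IsTridiagonalOn a b θ) {m : ℕ} {f : K[X]}
    (hf : f.degree < (m + 1 : ℕ)) {i j : Fin (d + 1)}
    (hij : (i : ℕ) + m < j ∨ (j : ℕ) + m < i) :
    idem a θ i * aeval b f * idem a θ j = 0 := by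
  rw [← mem_degreeLT, degreeLT_succ_eq_degreeLE, mem_degreeLE] at hf
  rw [aeval_eq_sum_range' (Nat.lt_succ_of_le (natDegree_le_of_degree_le hf)), Finset.mul_sum,
    Finset.sum_mul]
  refine Finset.sum_eq_zero fun k hk => ?_
  have := Finset.mem_range.1 hk
  rw [mul_smul_comm, smul_mul_assoc, h.idem_mul_pow_mul_idem k (by omega), smul_zero]

end IsTridiagonalOn

end LagrangeIdempotents

section Corner

variable {K : Type*} [Field K] {R : Type*} [Ring R] [Algebra K R] {a b : R} {d : ℕ}
  {θ : Fin (d + 1) → K}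

namespace IsTridiagonalOn

theorem idem_zero_mul_aeval_mul_aeval_congr (h : IsTridiagonalOn a b θ) {m : ℕ} {f g g' : K[X]}
    (hf : f.degree < (m + 1 : ℕ))
    (hg : ∀ i : Fin (d + 1), (i : ℕ) ≤ m → g.eval (θ i) = g'.eval (θ i)) :
    idem a θ 0 * aeval b f * aeval a g = idem a θ 0 * aeval b f * aeval a g' := by
  rw [h.aeval_eq_sum g, h.aeval_eq_sum g', Finset.mul_sum, Finset.mul_sum]
  refine Finset.sum_congr rfl fun i _ => ?_
  rcases le_or_gt (i : ℕ) m with hi | hi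
  · rw [hg i hi]
  · rw [mul_smul_comm, mul_smul_comm, h.idem_mul_aeval_mul_idem hf (Or.inl (by simpa using hi)),
      smul_zero, smul_zero]

theorem aeval_mul_aeval_mul_idem_zero_congr (h : IsTridiagonalOn a b θ) {m : ℕ} {f g g' : K[X]}
    (hf : f.degree < (m + 1 : ℕ))
    (hg : ∀ i : Fin (d + 1), (i : ℕ) ≤ m → g.eval (θ i) = g'.eval (θ i)) :
    aeval a g * (aeval b f * idem a θ 0) = aeval a g' * (aeval b f * idem a θ 0) := by
  rw [h.aeval_eq_sum g, h.aeval_eq_sum g', Finset.sum_mul, Finset.sum_mul]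
  refine Finset.sum_congr rfl fun i _ => ?_
  rcases le_or_gt (i : ℕ) m with hi | hi
  · rw [hg i hi]
  · rw [smul_mul_assoc, smul_mul_assoc, ← mul_assoc,
      h.idem_mul_aeval_mul_idem hf (Or.inr (by simpa using hi)), smul_zero, smul_zero]

end IsTridiagonalOn

/-- The elements `e f(a) w f'(a) e` are symmetric in the polynomials `f` and `f'`. -/
def IsCornerSymmetric (K : Type*) [Field K] [Algebra K R] (e a w : R) : Prop :=
  ∀ f f' : K[X], e * aeval a f * w * (aeval a f' * e) = e * aeval a f' * w * (aeval a f * e)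

theorem IsTridiagonalOn.corner_comm_of_degree_lt (h : IsTridiagonalOn a b θ) {m : ℕ}
    (hsymm : ∀ q : K[X], q.degree < m → IsCornerSymmetric K (idem a θ 0) b (aeval a q))
    {u : K[X]} (hu : u.degree < m) (g v : K[X]) :
    idem a θ 0 * aeval b u * aeval a g * (aeval b v * idem a θ 0) =
      idem a θ 0 * aeval b v * aeval a g * (aeval b u * idem a θ 0) := by
  obtain _ | m := m
  · have : u = 0 := by simpa using hu
    simp only [this, map_zero, mul_zero, zero_mul]
  obtain ⟨q, hq, hgq⟩ := exists_degree_lt_eval_eq h.injective g 0 (m + 1)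
  replace hgq (i : Fin (d + 1)) (hi : (i : ℕ) ≤ m) : g.eval (θ i) = q.eval (θ i) :=
    (hgq i (by simpa [Nat.lt_succ_iff] using hi)).symm
  rw [h.idem_zero_mul_aeval_mul_aeval_congr hu hgq, mul_assoc _ (aeval a g),
    h.aeval_mul_aeval_mul_idem_zero_congr hu hgq, ← mul_assoc _ (aeval a q)]
  exact hsymm q hq u v

variable {δ : ℕ} {θs : Fin (δ + 1) → K}

theorem IsTridiagonalOn.isCornerSymmetric_of_degree_lt (ha : IsTridiagonalOn a b θ)
    (hb : IsTridiagonalOn b a θs) (m : ℕ) (g : K[X]) (hg : g.degree < m) :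
    IsCornerSymmetric K (idem b θs 0) a (aeval b g) := by
  induction m generalizing g with
  | zero =>
    have : g = 0 := by simpa using hg
    simp only [IsCornerSymmetric, this, map_zero, mul_zero, zero_mul, implies_true]
  | succ m ih =>
    set e := idem b θs 0
    have hfar {i j : Fin (d + 1)} (hij : (i : ℕ) + m < j ∨ (j : ℕ) + m < i) :
        e * idem a θ i * aeval b g * (idem a θ j * e) = 0 := by
      calc _ = e * (idem a θ i * aeval b g * idem a θ j) * e := by simp only [mul_assoc]
        _ = 0 := by rw [ha.idem_mul_aeval_mul_idem hg hij, mul_zero, zero_mul]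
    have hβ := band_mem_of_moments_mem_of_antisymm (⊥ : Submodule K R) ha.injective (m := m)
      (β := fun i j => e * idem a θ i * aeval b g * (idem a θ j * e) -
        e * idem a θ j * aeval b g * (idem a θ i * e))
      (fun i => by rw [sub_self]; exact Submodule.zero_mem _)
      (fun i j => by rw [sub_add_sub_cancel, sub_self]; exact Submodule.zero_mem _)
      (fun i j hij => by rw [hfar (Or.inr hij), hfar (Or.inl hij), sub_self]; exact zero_mem _)
      (fun u hu j => by
        have h := hb.corner_comm_of_degree_lt ih hu g (Lagrange.basis Finset.univ θ j)
        rw [ha.aeval_eq_sum u, ← sub_eq_zero, ← idem] at h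
        simpa only [Finset.mul_sum, Finset.sum_mul, mul_smul_comm, smul_mul_assoc, smul_sub,
          Finset.sum_sub_distrib, Submodule.mem_bot] using h)
    intro f f'
    rw [ha.aeval_eq_sum f, ha.aeval_eq_sum f']
    simp only [Finset.mul_sum, Finset.sum_mul, mul_smul_comm, smul_mul_assoc, Finset.smul_sum]
    rw [Finset.sum_comm]
    refine Finset.sum_congr rfl fun i _ => Finset.sum_congr rfl fun j _ => ?_
    rw [sub_eq_zero.1 ((Submodule.mem_bot K).1 (hβ j i)), smul_comm]

theorem IsTridiagonalOn.commute_corner (ha : IsTridiagonalOn a b θ)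
    (hb : IsTridiagonalOn b a θs) (f f' : K[X]) :
    Commute (idem b θs 0 * aeval a f * idem b θs 0) (idem b θs 0 * aeval a f' * idem b θs 0) := by
  have hsymm := ha.isCornerSymmetric_of_degree_lt hb (δ + 1)
    (Lagrange.basis Finset.univ θs 0) (by
      rw [Lagrange.degree_basis hb.injective.injOn (Finset.mem_univ _), Finset.card_univ,
        Fintype.card_fin]
      exact_mod_cast Nat.lt_succ_self δ) f f'
  rw [← idem] at hsymm
  have hcorner (x y : R) : idem b θs 0 * x * idem b θs 0 * (idem b θs 0 * y * idem b θs 0) =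
      idem b θs 0 * x * idem b θs 0 * (y * idem b θs 0) := by
    rw [mul_assoc (idem b θs 0) y, ← mul_assoc _ (idem b θs 0) (y * _),
      mul_assoc _ (idem b θs 0) (idem b θs 0), hb.idem_mul_self]
  rw [commute_iff_eq, hcorner, hcorner, hsymm]

end Corner

section CornerGeneration

variable {K : Type*} [Field K] {R : Type*} [Ring R] [Algebra K R]

variable (K) in
/-- The subspace `K[a]` of polynomials in `a`. -/
noncomputable def polys (a : R) : Submodule K R :=
  LinearMap.range (aeval a : K[X] →ₐ[K] R).toLinearMap

variable (K) in
/-- The subspace of polynomials in `a` of degree less than `m`. -/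
noncomputable def polysLT (a : R) (m : ℕ) : Submodule K R :=
  (degreeLT K m).map (aeval a : K[X] →ₐ[K] R).toLinearMap

theorem aeval_mem_polys (a : R) (f : K[X]) : aeval a f ∈ polys K a :=
  ⟨f, rfl⟩

theorem aeval_mem_polysLT (a : R) {f : K[X]} {m : ℕ} (hf : f.degree < m) :
    aeval a f ∈ polysLT K a m :=
  ⟨f, mem_degreeLT.2 hf, rfl⟩

theorem polysLT_le_polys (a : R) (m : ℕ) : polysLT K a m ≤ polys K a :=
  LinearMap.map_le_range

theorem polysLT_zero (a : R) : polysLT K a 0 = ⊥ := by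
  refine le_bot_iff.1 (Submodule.map_le_iff_le_comap.2 fun f hf => ?_)
  have : f = 0 := by simpa [mem_degreeLT] using hf
  simp [this]

theorem mul_mul_le {L M N P : Submodule K R}
    (h : ∀ x ∈ L, ∀ y ∈ M, ∀ z ∈ N, x * y * z ∈ P) : L * M * N ≤ P :=
  Submodule.mul_le.2 fun t ht z hz => Submodule.mul_induction_on ht
    (fun x hx y hy => h x hx y hy z hz) fun t t' ht ht' => by
      rw [add_mul]
      exact P.add_mem ht ht'

theorem one_mem_polys (a : R) : (1 : R) ∈ polys K a :=
  ⟨1, map_one (aeval a)⟩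

theorem polys_mul_polys_le (a : R) : polys K a * polys K a ≤ polys K a := by
  rw [Submodule.mul_le]
  rintro _ ⟨f, rfl⟩ _ ⟨g, rfl⟩
  exact ⟨f * g, map_mul (aeval a) f g⟩

section

variable {d : ℕ} {a b : R} {θ : Fin (d + 1) → K}

theorem IsDiagonalizableWith.polys_le_polysLT (h : IsDiagonalizableWith a θ) :
    polys K a ≤ polysLT K a (d + 1) := by
  rintro _ ⟨f, rfl⟩
  rw [AlgHom.toLinearMap_apply, h.aeval_eq_sum f]
  refine Submodule.sum_mem _ fun i _ => Submodule.smul_mem _ _ (aeval_mem_polysLT a ?_)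
  rw [Lagrange.degree_basis h.injective.injOn (Finset.mem_univ _), Finset.card_univ,
    Fintype.card_fin]
  exact_mod_cast Nat.lt_succ_self d

theorem IsDiagonalizableWith.span_idem_mul_self (h : IsDiagonalizableWith a θ)
    (i : Fin (d + 1)) : (K ∙ idem a θ i) * (K ∙ idem a θ i) = K ∙ idem a θ i := by
  rw [Submodule.span_mul_span, Set.singleton_mul_singleton, h.idem_mul_self]

theorem IsDiagonalizableWith.span_idem_mul_polys_le (h : IsDiagonalizableWith a θ)
    (i : Fin (d + 1)) : (K ∙ idem a θ i) * polys K a ≤ K ∙ idem a θ i := by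
  rw [Submodule.mul_le]
  rintro x hx _ ⟨f, rfl⟩
  obtain ⟨c, rfl⟩ := Submodule.mem_span_singleton.1 hx
  rw [AlgHom.toLinearMap_apply, smul_mul_assoc, h.idem_mul_aeval]
  exact Submodule.smul_mem _ _ (Submodule.smul_mem _ _ (Submodule.mem_span_singleton_self _))

theorem IsDiagonalizableWith.polys_mul_span_idem_le (h : IsDiagonalizableWith a θ)
    (i : Fin (d + 1)) : polys K a * (K ∙ idem a θ i) ≤ K ∙ idem a θ i := by
  rw [Submodule.mul_le]
  rintro _ ⟨f, rfl⟩ x hx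
  obtain ⟨c, rfl⟩ := Submodule.mem_span_singleton.1 hx
  rw [AlgHom.toLinearMap_apply, mul_smul_comm, h.aeval_mul_idem]
  exact Submodule.smul_mem _ _ (Submodule.smul_mem _ _ (Submodule.mem_span_singleton_self _))

theorem IsDiagonalizableWith.exists_eval_eq_add_smul_basis (h : IsDiagonalizableWith a θ)
    (g : K[X]) (m : ℕ) : ∃ (q : K[X]) (c : K), q.degree < m ∧ ∀ i : Fin (d + 1), (i : ℕ) ≤ m →
      g.eval (θ i) = (q + c • Lagrange.basis Finset.univ θ 0).eval (θ i) := by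
  obtain ⟨q, hq, hgq⟩ := exists_degree_lt_eval_eq h.injective g 1 (m + 1)
  refine ⟨q, g.eval (θ 0) - q.eval (θ 0), by simpa using hq, fun i hi => ?_⟩
  rcases eq_or_ne i 0 with rfl | hi0
  · simp [Lagrange.eval_basis_self h.injective.injOn]
  · have := hgq i (Finset.mem_Ico.2 ⟨Nat.pos_of_ne_zero fun h0 => hi0 (Fin.ext h0),
      Nat.lt_succ_of_le hi⟩)
    simp [Lagrange.eval_basis_of_ne hi0.symm, this]

theorem IsTridiagonalOn.span_idem_zero_mul_polysLT_mul_polys_le (h : IsTridiagonalOn a b θ)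
    (m : ℕ) : (K ∙ idem a θ 0) * polysLT K b (m + 1) * polys K a ≤
      (K ∙ idem a θ 0) * polysLT K b (m + 1) * polysLT K a m ⊔
        (K ∙ idem a θ 0) * polysLT K b (m + 1) * (K ∙ idem a θ 0) := by
  rw [← Submodule.mul_sup]
  refine mul_mul_le ?_
  rintro _ hx _ ⟨f, hf, rfl⟩ _ ⟨g, rfl⟩
  obtain ⟨c, rfl⟩ := Submodule.mem_span_singleton.1 hx
  obtain ⟨q, c', hq, hgq⟩ := h.exists_eval_eq_add_smul_basis g m
  simp only [AlgHom.toLinearMap_apply, smul_mul_assoc]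
  rw [h.idem_zero_mul_aeval_mul_aeval_congr (mem_degreeLT.1 hf) hgq, map_add, map_smul]
  exact Submodule.smul_mem _ _ (Submodule.mul_mem_mul (Submodule.mul_mem_mul
    (Submodule.mem_span_singleton_self _) ⟨f, hf, rfl⟩) (Submodule.add_mem_sup
      (aeval_mem_polysLT a hq) (Submodule.smul_mem _ _ (Submodule.mem_span_singleton_self _))))

theorem IsTridiagonalOn.polys_mul_polysLT_mul_span_idem_zero_le (h : IsTridiagonalOn a b θ)
    (m : ℕ) : polys K a * polysLT K b (m + 1) * (K ∙ idem a θ 0) ≤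
      polysLT K a m * polysLT K b (m + 1) * (K ∙ idem a θ 0) ⊔
        (K ∙ idem a θ 0) * polysLT K b (m + 1) * (K ∙ idem a θ 0) := by
  rw [← Submodule.sup_mul, ← Submodule.sup_mul]
  refine mul_mul_le ?_
  rintro _ ⟨g, rfl⟩ _ ⟨f, hf, rfl⟩ _ hx
  obtain ⟨c, rfl⟩ := Submodule.mem_span_singleton.1 hx
  obtain ⟨q, c', hq, hgq⟩ := h.exists_eval_eq_add_smul_basis g m
  simp only [AlgHom.toLinearMap_apply, mul_smul_comm]
  rw [mul_assoc (aeval a g), h.aeval_mul_aeval_mul_idem_zero_congr (mem_degreeLT.1 hf) hgq,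
    ← mul_assoc (aeval a _), map_add, map_smul]
  exact Submodule.smul_mem _ _ (Submodule.mul_mem_mul (Submodule.mul_mem_mul (Submodule.add_mem_sup
      (aeval_mem_polysLT a hq) (Submodule.smul_mem _ _ (Submodule.mem_span_singleton_self _)))
    ⟨f, hf, rfl⟩) (Submodule.mem_span_singleton_self _))

theorem IsTridiagonalOn.polys_mul_polysLT_mul_polys_le (h : IsTridiagonalOn a b θ) (m : ℕ) :
    polys K a * polysLT K b (m + 1) * polys K a ≤
      polysLT K a (m + 1) * polysLT K b (m + 1) * polys K a ⊔
        polys K a * polysLT K b (m + 1) * polysLT K a m := by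
  refine mul_mul_le ?_
  rintro _ ⟨f, rfl⟩ y hy _ ⟨f', rfl⟩
  obtain ⟨g, hg, rfl⟩ := hy
  have hβ := band_mem_of_moments_mem (polysLT K a (m + 1) * polysLT K b (m + 1) * polys K a ⊔
      polys K a * polysLT K b (m + 1) * polysLT K a m) h.injective (m := m)
    (β := fun i j => idem a θ i * aeval b g * idem a θ j)
    (fun i j hij => by
      rw [h.idem_mul_aeval_mul_idem (mem_degreeLT.1 hg) hij]
      exact Submodule.zero_mem _)
    (fun u hu j => by
      simp only [← smul_mul_assoc, ← Finset.sum_mul, ← h.aeval_eq_sum]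
      exact Submodule.mem_sup_left (Submodule.mul_mem_mul (Submodule.mul_mem_mul
        (aeval_mem_polysLT a hu) ⟨g, hg, rfl⟩) (aeval_mem_polys a _)))
    (fun u hu i => by
      simp only [← mul_smul_comm, ← Finset.mul_sum, ← h.aeval_eq_sum]
      exact Submodule.mem_sup_right (Submodule.mul_mem_mul (Submodule.mul_mem_mul
        (aeval_mem_polys a _) ⟨g, hg, rfl⟩) (aeval_mem_polysLT a hu)))
  simp only [AlgHom.toLinearMap_apply]
  rw [h.aeval_eq_sum f, h.aeval_eq_sum f', Finset.mul_sum]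
  refine Submodule.sum_mem _ fun j _ => ?_
  rw [Finset.sum_mul, Finset.sum_mul]
  refine Submodule.sum_mem _ fun i _ => ?_
  rw [smul_mul_assoc, smul_mul_assoc, mul_smul_comm]
  exact Submodule.smul_mem _ _ (Submodule.smul_mem _ _ (hβ i j))

end

section

variable {x : Bool → R} {e : R}

variable (K x e) in
/-- The span of the alternating products `e ⋯ f₃(x !s) f₂(x s) f₁(x !s)` of length `k`, written
without the letter `x s` that is to be multiplied on the right next. -/
noncomputable def leftWord : Bool → ℕ → Submodule K R
  | _, 0 => K ∙ e
  | s, k + 1 => leftWord (!s) k * polys K (x !s)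

variable (K x e) in
/-- The span of the alternating products `f₁(x !s) f₂(x s) f₃(x !s) ⋯ e` of length `l`, to be
multiplied by the letter `x s` on the left next. -/
noncomputable def rightWord : Bool → ℕ → Submodule K R
  | _, 0 => K ∙ e
  | s, l + 1 => polys K (x !s) * rightWord (!s) l

theorem polys_mul_rightWord (s : Bool) (l : ℕ) :
    polys K (x s) * rightWord K x e s l = rightWord K x e (!s) (l + 1) := by
  rw [rightWord, Bool.not_not]

theorem polys_mul_rightWord_le (s t : Bool) (l : ℕ) :
    ∃ t' l', polys K (x s) * rightWord K x e t l ≤ rightWord K x e t' l' := by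
  rcases eq_or_ne s t with rfl | hst
  · exact ⟨_, _, (polys_mul_rightWord s l).le⟩
  rcases l with _ | l
  · exact ⟨!s, 1, (polys_mul_rightWord s 0).le⟩
  · refine ⟨t, l + 1, ?_⟩
    rw [rightWord, ← Bool.eq_not.2 hst, ← mul_assoc]
    exact mul_le_mul_left (polys_mul_polys_le _) _

theorem mem_iSup_rightWord_of_mem_adjoin {t : R} (ht : t ∈ Algebra.adjoin K (Set.range x)) {y : R}
    (hy : y ∈ ⨆ s, ⨆ l, rightWord K x e s l) : t * y ∈ ⨆ s, ⨆ l, rightWord K x e s l := by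
  have hx (s : Bool) : polys K (x s) * (⨆ s, ⨆ l, rightWord K x e s l) ≤
      ⨆ s, ⨆ l, rightWord K x e s l := by
    simp only [Submodule.mul_iSup, iSup_le_iff]
    intro t l
    obtain ⟨t', l', hle⟩ := polys_mul_rightWord_le (K := K) (x := x) (e := e) s t l
    exact hle.trans (le_iSup_of_le t' (le_iSup (rightWord K x e t') l'))
  induction ht using Algebra.adjoin_induction generalizing y with
  | mem t ht =>
    obtain ⟨s, rfl⟩ := ht
    exact hx s (Submodule.mul_mem_mul ⟨X, aeval_X _⟩ hy)
  | algebraMap c => exact (Algebra.smul_def c y) ▸ Submodule.smul_mem _ c hy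
  | add t t' _ _ ht ht' => exact add_mul t t' y ▸ add_mem (ht hy) (ht' hy)
  | mul t t' _ _ ht ht' => exact mul_assoc t t' y ▸ ht (ht' hy)

variable (K x e) in
/-- All products of total length `n`, one letter of which is a polynomial of degree less than `m`,
lie in `S`. -/
def WordsLE (S : Submodule K R) (n m : ℕ) : Prop :=
  ∀ s k l, k + l + 1 = n → leftWord K x e s k * polysLT K (x s) m * rightWord K x e s l ≤ S

variable {d : Bool → ℕ} {θ : ∀ s, Fin (d s + 1) → K} (h : ∀ s, IsTridiagonalOn (x s) (x !s) (θ s))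
  {S : Submodule K R}
include h

theorem interior_word_le (s : Bool) (k l m : ℕ) :
    leftWord K x e s (k + 1) * polysLT K (x s) (m + 1) * rightWord K x e s (l + 1) ≤
      leftWord K x e (!s) k * polysLT K (x !s) (m + 1) * rightWord K x e (!s) (l + 2) ⊔
        leftWord K x e (!s) (k + 2) * polysLT K (x !s) m * rightWord K x e (!s) l := by
  have hblock := (h (!s)).polys_mul_polysLT_mul_polys_le m
  rw [Bool.not_not] at hblock
  have := mul_le_mul_right (mul_le_mul_left hblock (rightWord K x e (!s) l))
    (leftWord K x e (!s) k)
  simp only [leftWord, rightWord, Bool.not_not, Submodule.mul_sup, Submodule.sup_mul, mul_assoc]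
    at this ⊢
  refine this.trans ?_
  gcongr <;> exact polysLT_le_polys _ _

variable (he : e = idem (x false) (θ false) 0)
include he

theorem span_mul_span_self_of_eq_idem : (K ∙ e) * (K ∙ e) = K ∙ e :=
  he ▸ (h false).span_idem_mul_self 0

theorem left_end_word_le (l m : ℕ) :
    (K ∙ e) * polysLT K (x true) (m + 1) * rightWord K x e true (l + 1) ≤
      leftWord K x e false 1 * polysLT K (x false) m * rightWord K x e false l ⊔
        (K ∙ e) * polysLT K (x true) (m + 1) * (K ∙ e) * ((K ∙ e) * rightWord K x e false l) := by
  have hred := mul_le_mul_left ((h false).span_idem_zero_mul_polysLT_mul_polys_le m)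
    (rightWord K x e false l)
  rw [← he, Submodule.sup_mul, Bool.not_false] at hred
  rw [rightWord, Bool.not_true, ← mul_assoc]
  refine hred.trans (sup_le_sup ?_ (le_of_eq ?_))
  · rw [leftWord, leftWord, Bool.not_false]
    gcongr
    exact polysLT_le_polys _ _
  · rw [← mul_assoc, mul_assoc _ (K ∙ e) (K ∙ e), span_mul_span_self_of_eq_idem h he]

theorem right_end_word_le (k m : ℕ) :
    leftWord K x e true (k + 1) * polysLT K (x true) (m + 1) * (K ∙ e) ≤
      leftWord K x e false k * polysLT K (x false) m * rightWord K x e false 1 ⊔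
        leftWord K x e false k * (K ∙ e) * ((K ∙ e) * polysLT K (x true) (m + 1) * (K ∙ e)) := by
  have hred := mul_le_mul_right ((h false).polys_mul_polysLT_mul_span_idem_zero_le m)
    (leftWord K x e false k)
  rw [← he, Submodule.mul_sup, Bool.not_false] at hred
  rw [leftWord, Bool.not_true, mul_assoc, mul_assoc, ← mul_assoc (polys K _)]
  refine hred.trans (sup_le_sup ?_ (le_of_eq ?_))
  · rw [rightWord, rightWord, Bool.not_false, mul_assoc, mul_assoc]
    gcongr
    exact polysLT_le_polys _ _
  · simp only [← mul_assoc]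
    rw [mul_assoc _ (K ∙ e) (K ∙ e), span_mul_span_self_of_eq_idem h he]

theorem span_mul_rightWord_le (hS : K ∙ e ≤ S) {l : ℕ} (hw : ∀ m, WordsLE K x e S l m)
    (s : Bool) : (K ∙ e) * rightWord K x e s l ≤ S := by
  rcases l with _ | l
  · rwa [rightWord, span_mul_span_self_of_eq_idem h he]
  · rw [rightWord, ← mul_assoc]
    exact (mul_le_mul_left (mul_le_mul_right (h _).polys_le_polysLT _) _).trans
      (hw _ (!s) 0 l (by omega))

theorem leftWord_mul_span_le (hS : K ∙ e ≤ S) {k : ℕ} (hw : ∀ m, WordsLE K x e S k m)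
    (s : Bool) : leftWord K x e s k * (K ∙ e) ≤ S := by
  rcases k with _ | k
  · rwa [leftWord, span_mul_span_self_of_eq_idem h he]
  · rw [leftWord]
    exact (mul_le_mul_left (mul_le_mul_right (h _).polys_le_polysLT _) _).trans
      (hw _ (!s) k 0 (by omega))

theorem span_le_of_corner_le (hcorner : (K ∙ e) * polys K (x true) * (K ∙ e) ≤ S) : K ∙ e ≤ S := by
  refine le_trans ?_ hcorner
  calc K ∙ e = (K ∙ e) * 1 * (K ∙ e) := by
        rw [mul_one, span_mul_span_self_of_eq_idem h he]
    _ ≤ (K ∙ e) * polys K (x true) * (K ∙ e) := by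
        gcongr
        exact Submodule.one_le.2 (one_mem_polys _)

theorem wordsLE (hS : S * S ≤ S)
    (hcorner : (K ∙ e) * polys K (x true) * (K ∙ e) ≤ S) (n m : ℕ) : WordsLE K x e S n m := by
  have he_le := span_le_of_corner_le h he hcorner
  induction n using Nat.strong_induction_on generalizing m with | _ n ih => ?_
  have hright (s l) (hl : l < n) := span_mul_rightWord_le h he he_le (ih l hl) s
  have hleft (s k) (hk : k < n) := leftWord_mul_span_le h he he_le (ih k hk) s
  -- The short letter is moved towards the left. Each move lowers its degree or brings it nearer to
  -- the end, where `e` absorbs it or the word splits at an inner `e` into shorter ones.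
  have hcorner_lt (m) : (K ∙ e) * polysLT K (x true) m * (K ∙ e) ≤ S :=
    (mul_le_mul_left (mul_le_mul_right (polysLT_le_polys _ _) _) _).trans hcorner
  induction m with
  | zero =>
    intro s k l _
    rw [polysLT_zero, Submodule.mul_bot, Submodule.bot_mul]
    exact bot_le
  | succ m ihm =>
    intro s k
    induction k generalizing s with
    | zero =>
      intro l hl
      rcases s with _ | _
      · refine (mul_le_mul_left ?_ _).trans (hright false l (by omega))
        rw [he]
        exact (mul_le_mul_right (polysLT_le_polys _ _) _).trans ((h false).span_idem_mul_polys_le 0)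
      · rcases l with _ | l
        · exact hcorner_lt _
        · exact (left_end_word_le h he l m).trans (sup_le (ihm false 1 l (by omega))
            ((mul_le_mul' (hcorner_lt _) (hright false l (by omega))).trans hS))
    | succ k ihk =>
      rintro (_ | l) hl
      · rcases s with _ | _
        · rw [mul_assoc]
          refine (mul_le_mul_right ?_ _).trans (hleft false (k + 1) (by omega))
          rw [rightWord, he]
          exact (mul_le_mul_left (polysLT_le_polys _ _) _).trans
            ((h false).polys_mul_span_idem_le 0)
        · exact (right_end_word_le h he k m).trans (sup_le (ihm false k 1 (by omega))
            ((mul_le_mul' (hleft false k (by omega)) (hcorner_lt _)).trans hS))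
      · exact (interior_word_le h s k l m).trans
          (sup_le (ihk (!s) (l + 2) (by omega)) (ihm (!s) (k + 2) l (by omega)))

end

theorem IsTridiagonalOn.corner_mem_of_mem_adjoin {d δ : ℕ} {a b : R} {θ : Fin (d + 1) → K}
    {θs : Fin (δ + 1) → K} {S : Submodule K R} (ha : IsTridiagonalOn a b θ)
    (hb : IsTridiagonalOn b a θs) (hS : S * S ≤ S)
    (hcorner : ∀ f : K[X], idem b θs 0 * aeval a f * idem b θs 0 ∈ S) {t : R}
    (ht : t ∈ Algebra.adjoin K {a, b}) : idem b θs 0 * t * idem b θs 0 ∈ S := by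
  let d' : Bool → ℕ := Bool.rec δ d
  let x : Bool → R := Bool.rec b a
  let θ' : ∀ s, Fin (d' s + 1) → K := Bool.rec θs θ
  have h : ∀ s, IsTridiagonalOn (x s) (x !s) (θ' s) := Bool.rec hb ha
  set e := idem b θs 0
  have hle : (K ∙ e) * polys K a * (K ∙ e) ≤ S := mul_mul_le <| by
    rintro _ hx _ ⟨f, rfl⟩ _ hz
    obtain ⟨c, rfl⟩ := Submodule.mem_span_singleton.1 hx
    obtain ⟨c', rfl⟩ := Submodule.mem_span_singleton.1 hz
    rw [smul_mul_assoc, smul_mul_assoc, mul_smul_comm]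
    exact S.smul_mem _ (S.smul_mem _ (hcorner f))
  have hte : t * e ∈ ⨆ s, ⨆ l, rightWord K x e s l := by
    refine mem_iSup_rightWord_of_mem_adjoin ?_ (Submodule.mem_iSup_of_mem true
      (Submodule.mem_iSup_of_mem 0 (Submodule.mem_span_singleton_self e)))
    rwa [Bool.range_eq, Set.pair_comm]
  have hword : (K ∙ e) * ⨆ s, ⨆ l, rightWord K x e s l ≤ S := by
    simp only [Submodule.mul_iSup, iSup_le_iff]
    exact fun s l => span_mul_rightWord_le h rfl (span_le_of_corner_le h rfl hle)
      (fun m => wordsLE h rfl hS hle l m) s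
  rw [mul_assoc]
  exact hword (Submodule.mul_mem_mul (Submodule.mem_span_singleton_self e) hte)

end CornerGeneration

section StandardEigenvalues

variable {K : Type*} [Field K] {V : Type*} [AddCommGroup V] [Module K V] {d : ℕ}

theorem aeval_apply_of_mem_eigenspace {A : End K V} {μ : K} {x : V} (hx : x ∈ A.eigenspace μ)
    (f : K[X]) : aeval A f x = f.eval μ • x := by
  rcases eq_or_ne x 0 with rfl | h0
  · rw [map_zero, smul_zero]
  · exact End.aeval_apply_of_hasEigenvector ⟨hx, h0⟩

theorem eq_of_eigenspace_eq {A : End K V} {μ ν : K} (h : A.eigenspace μ = A.eigenspace ν)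
    (hμ : A.eigenspace μ ≠ ⊥) : μ = ν := by
  obtain ⟨x, hx, hx0⟩ := Submodule.exists_mem_ne_zero_of_ne_bot hμ
  exact smul_left_injective K hx0
    ((End.mem_eigenspace_iff.1 hx).symm.trans (End.mem_eigenspace_iff.1 (h ▸ hx)))

theorem IsDiagonalizableWith.range_idem {ι : Type*} [Fintype ι] [DecidableEq ι] {A : End K V}
    {θ : ι → K} (h : IsDiagonalizableWith A θ) (i : ι) :
    LinearMap.range (idem A θ i) = A.eigenspace (θ i) := by
  refine le_antisymm ?_ fun x hx => ⟨x, ?_⟩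
  · rintro _ ⟨x, rfl⟩
    have := LinearMap.congr_fun (h.aeval_mul_idem X i) x
    rw [aeval_X, eval_X] at this
    exact End.mem_eigenspace_iff.2 this
  · rw [idem, aeval_apply_of_mem_eigenspace hx,
      Lagrange.eval_basis_self h.injective.injOn (Finset.mem_univ i), one_smul]

/-- `θ 0, …, θ d` are the eigenvalues of the diagonalizable map `A`, in an order that is standard
with respect to `B`. -/
structure IsStandardEigenvalues (A B : End K V) (θ : Fin (d + 1) → K) : Prop where
  injective : Function.Injective θ
  ne_bot : ∀ i, A.eigenspace (θ i) ≠ ⊥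
  iSup_eq_top : ⨆ i, A.eigenspace (θ i) = ⊤
  tridiagonal : ∀ i, (A.eigenspace (θ i)).map B ≤
    ⨆ j : Fin (d + 1), ⨆ _ : (j : ℕ) ≤ (i : ℕ) + 1 ∧ (i : ℕ) ≤ (j : ℕ) + 1, A.eigenspace (θ j)

theorem IsStandardOrdering.isStandardEigenvalues {A B : End K V}
    {W : Fin (d + 1) → Submodule K V} (h : IsStandardOrdering A B W) (hA : IsDiagonalizable A)
    {θ : Fin (d + 1) → K} (hθ : ∀ i, W i = A.eigenspace (θ i)) : IsStandardEigenvalues A B θ where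
  injective i j hij := h.injective (by rw [hθ, hθ, hij])
  ne_bot i := by
    have : W i ∈ {U : Submodule K V | IsEigenspace A U} := h.range_eq ▸ Set.mem_range_self i
    exact hθ i ▸ this.1
  iSup_eq_top := by rwa [IsDiagonalizable, ← h.range_eq, sSup_range, iSup_congr hθ] at hA
  tridiagonal := by simpa only [hθ] using h.tridiagonal

theorem IsStandardOrdering.exists_eigenvalues {A B : End K V}
    {W : Fin (d + 1) → Submodule K V} (h : IsStandardOrdering A B W) :
    ∃ θ : Fin (d + 1) → K, ∀ i, W i = A.eigenspace (θ i) := by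
  refine Classical.skolem (p := fun i μ => W i = A.eigenspace μ) |>.1 fun i => ?_
  have hi : W i ∈ {U : Submodule K V | IsEigenspace A U} := h.range_eq ▸ Set.mem_range_self i
  exact hi.2

namespace IsStandardEigenvalues

variable {A B : End K V} {θ : Fin (d + 1) → K}

theorem hom_ext (h : IsStandardEigenvalues A B θ) {f g : End K V}
    (hfg : ∀ i, ∀ x ∈ A.eigenspace (θ i), f x = g x) : f = g := by
  refine LinearMap.ext fun x => ?_
  have hx : x ∈ ⨆ i, A.eigenspace (θ i) := h.iSup_eq_top ▸ Submodule.mem_top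
  refine Submodule.iSup_induction _ (motive := fun x => f x = g x) hx hfg
    (by rw [map_zero, map_zero]) fun x y hx hy => ?_
  rw [map_add, map_add, hx, hy]

theorem idem_apply_of_mem (h : IsStandardEigenvalues A B θ) {i j : Fin (d + 1)} {x : V}
    (hx : x ∈ A.eigenspace (θ j)) : idem A θ i x = if i = j then x else 0 := by
  rw [idem, aeval_apply_of_mem_eigenspace hx]
  split_ifs with hij
  · rw [hij, Lagrange.eval_basis_self h.injective.injOn (Finset.mem_univ _), one_smul]
  · rw [Lagrange.eval_basis_of_ne hij (Finset.mem_univ _), zero_smul]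

theorem isTridiagonalOn (h : IsStandardEigenvalues A B θ) : IsTridiagonalOn A B θ where
  injective := h.injective
  aeval_nodal := h.hom_ext fun i x hx => by
    rw [aeval_apply_of_mem_eigenspace hx, Lagrange.eval_nodal_at_node (Finset.mem_univ i),
      zero_smul, LinearMap.zero_apply]
  tri i j hij := h.hom_ext fun k x hx => by
    rw [End.mul_apply, End.mul_apply, h.idem_apply_of_mem hx, LinearMap.zero_apply]
    split_ifs with hjk
    · subst hjk
      have hle : (⨆ l : Fin (d + 1), ⨆ _ : (l : ℕ) ≤ (j : ℕ) + 1 ∧ (j : ℕ) ≤ (l : ℕ) + 1,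
          A.eigenspace (θ l)) ≤ LinearMap.ker (idem A θ i) := by
        refine iSup_le fun l => iSup_le fun hl y hy => ?_
        rw [LinearMap.mem_ker, h.idem_apply_of_mem hy, if_neg (by rintro rfl; omega)]
      exact hle (h.tridiagonal j (Submodule.mem_map_of_mem hx))
    · rw [map_zero, map_zero]

theorem exists_eq (h : IsStandardEigenvalues A B θ) {μ : K} (hμ : A.eigenspace μ ≠ ⊥) :
    ∃ i, μ = θ i := by
  obtain ⟨x, hx, hx0⟩ := Submodule.exists_mem_ne_zero_of_ne_bot hμ
  have hroot := aeval_apply_of_mem_eigenspace hx (Lagrange.nodal Finset.univ θ)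
  rw [h.isTridiagonalOn.aeval_nodal, LinearMap.zero_apply, eq_comm, smul_eq_zero_iff_left hx0,
    Lagrange.eval_nodal, Finset.prod_eq_zero_iff] at hroot
  obtain ⟨i, -, hi⟩ := hroot
  exact ⟨i, sub_eq_zero.1 hi⟩

theorem isStandardOrdering (h : IsStandardEigenvalues A B θ) :
    IsStandardOrdering A B fun i => A.eigenspace (θ i) where
  injective i _ hij := h.injective (eq_of_eigenspace_eq hij (h.ne_bot i))
  range_eq := by
    ext U
    constructor
    · rintro ⟨i, rfl⟩
      exact ⟨h.ne_bot i, θ i, rfl⟩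
    · rintro ⟨hU, μ, rfl⟩
      obtain ⟨i, rfl⟩ := h.exists_eq hU
      exact ⟨i, rfl⟩
  tridiagonal := h.tridiagonal

theorem isStandardIdempotents (h : IsStandardEigenvalues A B θ) :
    IsStandardIdempotents A B (idem A θ) :=
  ⟨_, h.isStandardOrdering, fun i v hv => by rw [h.idem_apply_of_mem hv, if_pos rfl],
    fun i j hij v hv => by rw [h.idem_apply_of_mem hv, if_neg hij.symm]⟩

end IsStandardEigenvalues

end StandardEigenvalues

section Duality

variable {K : Type*} [Field K] {V : Type*} [AddCommGroup V] [Module K V] {d δ : ℕ}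
  {A B : End K V} {θ : Fin (d + 1) → K} {θs : Fin (δ + 1) → K}

/-- The sum of the eigenspaces of `A` for the eigenvalues `θ k` with `k ∈ s`. -/
def eigenSum (A : End K V) (θ : Fin (d + 1) → K) (s : Set ℕ) : Submodule K V :=
  ⨆ k : Fin (d + 1), ⨆ _ : (k : ℕ) ∈ s, A.eigenspace (θ k)

theorem eigenspace_le_eigenSum {s : Set ℕ} {k : Fin (d + 1)} (hk : (k : ℕ) ∈ s) :
    A.eigenspace (θ k) ≤ eigenSum A θ s :=
  le_iSup₂_of_le k hk le_rfl

theorem eigenSum_le {s : Set ℕ} {U : Submodule K V}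
    (hU : ∀ k : Fin (d + 1), (k : ℕ) ∈ s → A.eigenspace (θ k) ≤ U) : eigenSum A θ s ≤ U :=
  iSup₂_le hU

theorem eigenSum_mono {s t : Set ℕ} (hst : s ⊆ t) : eigenSum A θ s ≤ eigenSum A θ t :=
  eigenSum_le fun _ hk => eigenspace_le_eigenSum (hst hk)

theorem eigenSum_eq_bot {s : Set ℕ} (hs : ∀ k ∈ s, d < k) : eigenSum A θ s = ⊥ :=
  le_bot_iff.1 (eigenSum_le fun k hk => absurd (hs k hk) (by omega))

theorem eigenspace_sup_eigenSum (i : Fin (d + 1)) (s : Set ℕ) :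
    A.eigenspace (θ i) ⊔ eigenSum A θ s = eigenSum A θ (insert ↑i s) := by
  refine le_antisymm (sup_le (eigenspace_le_eigenSum (Set.mem_insert _ s))
    (eigenSum_mono (Set.subset_insert _ s))) (eigenSum_le fun k hk => ?_)
  rcases hk with hk | hk
  · exact Fin.ext hk ▸ le_sup_left
  · exact (eigenspace_le_eigenSum hk).trans le_sup_right

theorem exists_apply_sub_smul_mem_eigenSum (A : End K V) (θ : Fin (d + 1) → K) (s : Set ℕ) (i : ℕ) :
    ∃ μ : K, ∀ x ∈ eigenSum A θ s, A x - μ • x ∈ eigenSum A θ (s \ {i}) := by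
  obtain ⟨μ, hμ⟩ : ∃ μ, ∀ k : Fin (d + 1), (k : ℕ) = i → θ k = μ := by
    by_cases hi : i < d + 1
    · exact ⟨θ ⟨i, hi⟩, fun k hk => congrArg θ (Fin.ext hk)⟩
    · exact ⟨0, fun k hk => absurd k.2 (hk ▸ hi)⟩
  refine ⟨μ, fun x hx => ?_⟩
  have hle : eigenSum A θ s ≤ (eigenSum A θ (s \ {i})).comap (A - μ • 1) :=
    eigenSum_le fun k hk y hy => by
      rw [Submodule.mem_comap, LinearMap.sub_apply, LinearMap.smul_apply, End.one_apply,
        End.mem_eigenspace_iff.1 hy, ← sub_smul]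
      rcases eq_or_ne (k : ℕ) i with hki | hki
      · rw [hμ k hki, sub_self, zero_smul]
        exact Submodule.zero_mem _
      · exact Submodule.smul_mem _ _ (eigenspace_le_eigenSum (s := s \ {i}) ⟨hk, hki⟩ hy)
  exact hle hx

namespace IsStandardEigenvalues

theorem eigenSum_eq_top (h : IsStandardEigenvalues A B θ) {s : Set ℕ} (hs : ∀ k ≤ d, k ∈ s) :
    eigenSum A θ s = ⊤ := by
  rw [← top_le_iff, ← h.iSup_eq_top]
  exact iSup_le fun k => eigenspace_le_eigenSum (hs k (by omega))

theorem disjoint_eigenSum (h : IsStandardEigenvalues A B θ) {i : Fin (d + 1)} {s : Set ℕ}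
    (hi : (i : ℕ) ∉ s) : Disjoint (A.eigenspace (θ i)) (eigenSum A θ s) :=
  (A.eigenspaces_iSupIndep.comp h.injective).disjoint_biSup (y := {k | (k : ℕ) ∈ s}) hi

theorem eigenSum_ne_top (h : IsStandardEigenvalues A B θ) {i : Fin (d + 1)} {s : Set ℕ}
    (hi : (i : ℕ) ∉ s) : eigenSum A θ s ≠ ⊤ := fun htop =>
  h.ne_bot i (disjoint_top.1 (htop ▸ h.disjoint_eigenSum hi))

theorem map_eigenSum_le (h : IsStandardEigenvalues A B θ) {s t : Set ℕ}
    (hst : ∀ k ∈ s, ∀ j, j ≤ k + 1 → k ≤ j + 1 → j ∈ t) :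
    (eigenSum A θ s).map B ≤ eigenSum A θ t :=
  Submodule.map_le_iff_le_comap.2 <| eigenSum_le fun k hk =>
    Submodule.map_le_iff_le_comap.1 <| (h.tridiagonal k).trans <|
      iSup₂_le fun j hj => eigenspace_le_eigenSum (hst k hk j hj.1 hj.2)

end IsStandardEigenvalues

/-- No subspace other than `0` and `V` is invariant under both `A` and `B`. -/
def ActsIrreducibly (A B : End K V) : Prop :=
  ∀ W : Submodule K V, W.map A ≤ W → W.map B ≤ W → W = ⊥ ∨ W = ⊤

theorem ActsIrreducibly.symm (h : ActsIrreducibly A B) : ActsIrreducibly B A :=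
  fun W hB hA => h W hA hB

/-- The sum over `i` of the intersections of the flags `E^*_0V + ⋯ + E^*_{i+c-1}V` and
`E_iV + ⋯ + E_dV`; it is invariant for every shift `c`, being trivial for `c = 0` and everything
for `c = 1`. -/
def flagSum (A B : End K V) (θ : Fin (d + 1) → K) (θs : Fin (δ + 1) → K) (c : ℕ) :
    Submodule K V :=
  ⨆ i : ℕ, eigenSum B θs (Set.Iio (i + c)) ⊓ eigenSum A θ (Set.Ici i)

namespace IsStandardEigenvalues

variable (h : IsStandardEigenvalues A B θ) (hs : IsStandardEigenvalues B A θs)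

include hs in
theorem map_left_flagSum_le (θ : Fin (d + 1) → K) (c : ℕ) :
    (flagSum A B θ θs c).map A ≤ flagSum A B θ θs c := by
  simp only [flagSum, Submodule.map_iSup, iSup_le_iff]
  rintro i _ ⟨x, ⟨hxs, hx⟩, rfl⟩
  obtain ⟨μ, hμ⟩ := exists_apply_sub_smul_mem_eigenSum A θ (Set.Ici i) i
  have hAx : A x ∈ eigenSum B θs (Set.Iio (i + 1 + c)) :=
    hs.map_eigenSum_le (fun k hk j hj _ => by simp only [Set.mem_Iio] at hk ⊢; omega)
      (Submodule.mem_map_of_mem hxs)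
  have hxs' : x ∈ eigenSum B θs (Set.Iio (i + 1 + c)) :=
    eigenSum_mono (Set.Iio_subset_Iio (by omega)) hxs
  rw [← sub_add_cancel (A x) (μ • x)]
  refine add_mem (Submodule.mem_iSup_of_mem (i + 1) ⟨sub_mem hAx (Submodule.smul_mem _ μ hxs'),
    eigenSum_mono (fun k hk => ?_) (hμ x hx)⟩)
    (Submodule.smul_mem _ μ (Submodule.mem_iSup_of_mem i ⟨hxs, hx⟩))
  simp only [Set.mem_sdiff, Set.mem_Ici, Set.mem_singleton_iff] at hk ⊢
  omega

include h in
theorem map_right_flagSum_le (θs : Fin (δ + 1) → K) (c : ℕ) :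
    (flagSum A B θ θs c).map B ≤ flagSum A B θ θs c := by
  simp only [flagSum, Submodule.map_iSup, iSup_le_iff]
  rintro i _ ⟨x, ⟨hxs, hx⟩, rfl⟩
  obtain ⟨μ, hμ⟩ := exists_apply_sub_smul_mem_eigenSum B θs (Set.Iio (i + c)) (i + c - 1)
  have hBx : B x ∈ eigenSum A θ (Set.Ici (i - 1)) :=
    h.map_eigenSum_le (fun k hk j _ hj => by simp only [Set.mem_Ici] at hk ⊢; omega)
      (Submodule.mem_map_of_mem hx)
  have hx' : x ∈ eigenSum A θ (Set.Ici (i - 1)) :=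
    eigenSum_mono (Set.Ici_subset_Ici.2 (Nat.sub_le i 1)) hx
  rw [← sub_add_cancel (B x) (μ • x)]
  refine add_mem (Submodule.mem_iSup_of_mem (i - 1) ⟨eigenSum_mono (fun k hk => ?_) (hμ x hxs),
    sub_mem hBx (Submodule.smul_mem _ μ hx')⟩)
    (Submodule.smul_mem _ μ (Submodule.mem_iSup_of_mem i ⟨hxs, hx⟩))
  simp only [Set.mem_sdiff, Set.mem_Iio, Set.mem_singleton_iff] at hk ⊢
  omega

variable (hirr : ActsIrreducibly A B)
include h hs hirr

theorem isCompl_eigenSum (i : ℕ) :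
    IsCompl (eigenSum B θs (Set.Iio i)) (eigenSum A θ (Set.Ici i)) := by
  constructor
  · have hbot : flagSum A B θ θs 0 = ⊥ := by
      refine (hirr _ (map_left_flagSum_le hs θ 0) (map_right_flagSum_le h θs 0)).resolve_right
        fun htop => h.eigenSum_ne_top (i := 0) (s := Set.Ici 1) (by simp) ?_
      rw [← top_le_iff, ← htop]
      refine iSup_le fun k => ?_
      rcases Nat.eq_zero_or_pos k with rfl | hk
      · rw [eigenSum_eq_bot (s := Set.Iio (0 + 0)) (by simp), bot_inf_eq]
        exact bot_le
      · exact inf_le_right.trans (eigenSum_mono (Set.Ici_subset_Ici.2 hk))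
    exact disjoint_iff_inf_le.2 ((le_iSup (fun i : ℕ => eigenSum B θs (Set.Iio (i + 0)) ⊓
      eigenSum A θ (Set.Ici i)) i).trans_eq hbot)
  · have htop : flagSum A B θ θs 1 = ⊤ := by
      refine (hirr _ (map_left_flagSum_le hs θ 1) (map_right_flagSum_le h θs 1)).resolve_left
        fun hbot => hs.ne_bot 0 (le_bot_iff.1 (le_trans ?_ hbot.le))
      refine le_iSup_of_le 0 (le_inf (eigenspace_le_eigenSum (by simp)) ?_)
      rw [h.eigenSum_eq_top fun k _ => Set.mem_Ici.2 (Nat.zero_le k)]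
      exact le_top
    rw [codisjoint_iff_le_sup, ← htop]
    refine iSup_le fun k => ?_
    rcases lt_or_ge k i with hk | hk
    · exact inf_le_left.trans ((eigenSum_mono (Set.Iio_subset_Iio hk)).trans le_sup_left)
    · exact inf_le_right.trans ((eigenSum_mono (Set.Ici_subset_Ici.2 hk)).trans le_sup_right)

theorem diameter_le : δ ≤ d := by
  by_contra! hlt
  have htop := (h.isCompl_eigenSum hs hirr (d + 1)).sup_eq_top
  rw [eigenSum_eq_bot (s := Set.Ici (d + 1)) fun k hk => Nat.lt_of_succ_le hk, sup_bot_eq] at htop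
  exact hs.eigenSum_ne_top (i := ⟨d + 1, by omega⟩) (by simp) htop

theorem diameter_eq : d = δ :=
  le_antisymm (hs.diameter_le h hirr.symm) (h.diameter_le hs hirr)

theorem finrank_eigenspace_eq {i : Fin (d + 1)} {j : Fin (δ + 1)} (hij : (i : ℕ) = j) :
    finrank K (A.eigenspace (θ i)) = finrank K (B.eigenspace (θs j)) := by
  have hIci : eigenSum A θ (Set.Ici (i + 1)) ⊔ A.eigenspace (θ i) = eigenSum A θ (Set.Ici i) := by
    rw [sup_comm, eigenspace_sup_eigenSum]
    congr 1
    ext k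
    simp only [Set.mem_insert_iff, Set.mem_Ici]
    omega
  have hIio : B.eigenspace (θs j) ⊔ eigenSum B θs (Set.Iio i) =
      eigenSum B θs (Set.Iio (i + 1)) := by
    rw [eigenspace_sup_eigenSum]
    congr 1
    ext k
    simp only [Set.mem_insert_iff, Set.mem_Iio]
    omega
  -- The two eigenspaces have a common complement.
  have hA : IsCompl (eigenSum B θs (Set.Iio i) ⊔ eigenSum A θ (Set.Ici (i + 1)))
      (A.eigenspace (θ i)) :=
    (h.disjoint_eigenSum (by simp)).symm.isCompl_sup_left_of_isCompl_sup_right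
      (hIci ▸ h.isCompl_eigenSum hs hirr i)
  have hB : IsCompl (eigenSum B θs (Set.Iio i) ⊔ eigenSum A θ (Set.Ici (i + 1)))
      (B.eigenspace (θs j)) :=
    ((hs.disjoint_eigenSum (by simp [hij])).isCompl_sup_right_of_isCompl_sup_left
      (hIio ▸ h.isCompl_eigenSum hs hirr (i + 1))).symm
  exact ((Submodule.quotientEquivOfIsCompl _ _ hA).symm.trans
    (Submodule.quotientEquivOfIsCompl _ _ hB)).finrank_eq

end IsStandardEigenvalues

theorem isSharp_of_finrank_eq_one {θs : Fin (d + 1) → K} (h : IsStandardEigenvalues A B θ)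
    (hs : IsStandardEigenvalues B A θs) (hirr : ActsIrreducibly A B)
    (hrank : finrank K (B.eigenspace (θs 0)) = 1) : IsSharp A B :=
  ⟨d, fun i => finrank K (B.eigenspace (θs i)), ⟨_, _, h.isStandardOrdering,
    hs.isStandardOrdering, fun _ => ⟨h.finrank_eigenspace_eq hs hirr rfl, rfl⟩⟩, hrank⟩

end Duality

section Sharpness

theorem finrank_eq_one_of_isSimpleModule {K C M : Type*} [Field K] [IsAlgClosed K] [CommRing C]
    [Algebra K C] [Algebra.FiniteType K C] [AddCommGroup M] [Module K M] [Module C M]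
    [IsScalarTower K C M] [IsSimpleModule C M] : finrank K M = 1 := by
  obtain ⟨I, hI, ⟨e⟩⟩ := isSimpleModule_iff_quot_maximal.1 ‹IsSimpleModule C M›
  let := Ideal.Quotient.field I
  have : Module.Finite K (C ⧸ I) := finite_of_finite_type_of_isJacobsonRing K (C ⧸ I)
  rw [(e.restrictScalars K).finrank_eq, ← Module.finrank_self K]
  exact (LinearEquiv.ofBijective (Algebra.linearMap K (C ⧸ I))
    IsAlgClosed.algebraMap_bijective_of_isIntegral).finrank_eq.symm

variable {K : Type*} [Field K] {V : Type*} [AddCommGroup V] [Module K V]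

open scoped IsMulCommutative in
theorem finrank_eq_one_of_commute [IsAlgClosed K] {S : Set (End K V)} (hS : S.Finite)
    (hcomm : ∀ s ∈ S, ∀ t ∈ S, s * t = t * s) {W : Submodule K V} (hW : W ≠ ⊥)
    (hinv : ∀ t ∈ Algebra.adjoin K S, ∀ x ∈ W, t x ∈ W)
    (htrans : ∀ x ∈ W, x ≠ 0 → ∀ y ∈ W, ∃ t ∈ Algebra.adjoin K S, t x = y) :
    finrank K W = 1 := by
  have := Algebra.isMulCommutative_adjoin K hcomm
  have : Algebra.FiniteType K (Algebra.adjoin K S) :=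
    ⟨(Algebra.adjoin K S).fg_top.2 ⟨hS.toFinset, by rw [hS.coe_toFinset]⟩⟩
  let N : Submodule (Algebra.adjoin K S) V :=
    { W.toAddSubmonoid with smul_mem' := fun t x hx => hinv t t.2 x hx }
  have : IsSimpleModule (Algebra.adjoin K S) N := by
    refine isSimpleModule_iff_toSpanSingleton_surjective.2
      ⟨Submodule.nontrivial_iff_ne_bot.2 fun hN => hW ?_, fun x hx y => ?_⟩
    · exact (Submodule.eq_bot_iff W).2 fun x hx => (Submodule.eq_bot_iff N).1 hN x hx
    · obtain ⟨t, ht, htx⟩ := htrans x x.2 (by simpa using hx) y y.2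
      exact ⟨⟨t, ht⟩, Subtype.ext htx⟩
  exact finrank_eq_one_of_isSimpleModule (C := Algebra.adjoin K S) (M := N)

variable {A B : End K V}

/-- The smallest subspace that contains `v` and is invariant under `A` and `B`. -/
def cyclicSubmodule (A B : End K V) (v : V) : Submodule K V :=
  (Algebra.adjoin K {A, B}).toSubmodule.map (LinearMap.applyₗ v)

theorem mem_cyclicSubmodule {v w : V} :
    w ∈ cyclicSubmodule A B v ↔ ∃ t ∈ Algebra.adjoin K {A, B}, t v = w :=
  Iff.rfl

theorem mem_cyclicSubmodule_self (A B : End K V) (v : V) : v ∈ cyclicSubmodule A B v :=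
  mem_cyclicSubmodule.2 ⟨1, one_mem _, rfl⟩

theorem apply_mem_cyclicSubmodule {T : End K V} (hT : T ∈ Algebra.adjoin K {A, B}) {v w : V}
    (hw : w ∈ cyclicSubmodule A B v) : T w ∈ cyclicSubmodule A B v := by
  obtain ⟨t, ht, rfl⟩ := hw
  exact mem_cyclicSubmodule.2 ⟨T * t, mul_mem hT ht, rfl⟩

theorem left_mem_adjoin (A B : End K V) : A ∈ Algebra.adjoin K {A, B} :=
  Algebra.subset_adjoin (Set.mem_insert A _)

theorem right_mem_adjoin (A B : End K V) : B ∈ Algebra.adjoin K {A, B} :=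
  Algebra.subset_adjoin (Set.mem_insert_of_mem A rfl)

theorem ActsIrreducibly.cyclicSubmodule_eq_top (h : ActsIrreducibly A B) {v : V} (hv : v ≠ 0) :
    cyclicSubmodule A B v = ⊤ := by
  refine (h _ ?_ ?_).resolve_left fun hbot => hv ?_
  · exact Submodule.map_le_iff_le_comap.2 fun _ => apply_mem_cyclicSubmodule (left_mem_adjoin A B)
  · exact Submodule.map_le_iff_le_comap.2 fun _ => apply_mem_cyclicSubmodule (right_mem_adjoin A B)
  · exact (Submodule.mem_bot K).1 (hbot ▸ mem_cyclicSubmodule_self A B v)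

theorem ActsIrreducibly.exists_mem_adjoin_apply_eq (h : ActsIrreducibly A B) {v : V} (hv : v ≠ 0)
    (w : V) : ∃ t ∈ Algebra.adjoin K {A, B}, t v = w :=
  mem_cyclicSubmodule.1 (h.cyclicSubmodule_eq_top hv ▸ Submodule.mem_top)

variable {d δ : ℕ} {θ : Fin (d + 1) → K} {θs : Fin (δ + 1) → K}

namespace IsStandardEigenvalues

variable (h : IsStandardEigenvalues A B θ) (hs : IsStandardEigenvalues B A θs)
include h hs

theorem corner_mem_adjoin_corner_idem {t : End K V} (ht : t ∈ Algebra.adjoin K {A, B}) :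
    idem B θs 0 * t * idem B θs 0 ∈ Algebra.adjoin K
      (Set.range fun i => idem B θs 0 * idem A θ i * idem B θs 0) := by
  set C := Algebra.adjoin K (Set.range fun i => idem B θs 0 * idem A θ i * idem B θs 0)
  have hcorner (f : K[X]) : idem B θs 0 * aeval A f * idem B θs 0 ∈ C.toSubmodule := by
    rw [h.isTridiagonalOn.aeval_eq_sum, Finset.mul_sum, Finset.sum_mul]
    refine sum_mem fun i _ => ?_
    rw [mul_smul_comm, smul_mul_assoc]
    exact C.smul_mem (Algebra.subset_adjoin ⟨i, rfl⟩) _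
  exact h.isTridiagonalOn.corner_mem_of_mem_adjoin hs.isTridiagonalOn
    C.isIdempotentElem_toSubmodule.le hcorner ht

theorem finrank_eigenspace_zero [IsAlgClosed K] (hirr : ActsIrreducibly A B) :
    finrank K (B.eigenspace (θs 0)) = 1 := by
  set e := idem B θs 0 with he
  have hfix {x : V} (hx : x ∈ B.eigenspace (θs 0)) : e x = x := by
    rw [he, hs.idem_apply_of_mem hx, if_pos rfl]
  have hmem (x : V) : e x ∈ B.eigenspace (θs 0) :=
    hs.isTridiagonalOn.range_idem 0 ▸ LinearMap.mem_range_self e x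
  refine finrank_eq_one_of_commute (Set.finite_range fun i => e * idem A θ i * e) ?_ (hs.ne_bot 0)
    (fun t ht => ?_) fun x hx hx0 y hy => ?_
  · rintro _ ⟨i, rfl⟩ _ ⟨j, rfl⟩
    exact h.isTridiagonalOn.commute_corner hs.isTridiagonalOn _ _
  · induction ht using Algebra.adjoin_induction with
    | mem t ht =>
      obtain ⟨i, rfl⟩ := ht
      exact fun x _ => hmem _
    | algebraMap c => exact fun x hx => Submodule.smul_mem _ c hx
    | add _ _ _ _ hs ht => exact fun x hx => add_mem (hs x hx) (ht x hx)
    | mul _ _ _ _ hs ht => exact fun x hx => hs _ (ht x hx)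
  · obtain ⟨t, ht, rfl⟩ := hirr.exists_mem_adjoin_apply_eq hx0 y
    refine ⟨e * t * e, h.corner_mem_adjoin_corner_idem hs ht, ?_⟩
    rw [End.mul_apply, End.mul_apply, hfix hx, hfix hy]

end IsStandardEigenvalues

end Sharpness

section Isomorphism

variable {K : Type*} [Field K] {d δ : ℕ}

theorem mem_of_newton_mem {θ : Fin (d + 1) → K} {S : Submodule K K[X]}
    (hS : ∀ i, ∏ j ∈ Finset.Iio i, (X - C (θ j)) ∈ S)
    (hnodal : ∀ f, Lagrange.nodal Finset.univ θ ∣ f → f ∈ S) (f : K[X]) : f ∈ S := by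
  let τ (i : ℕ) : K[X] := (∏ j : Fin (d + 1) with j.val < i, (X - C (θ j))) * X ^ (i - (d + 1))
  have hmonic (i : ℕ) : (τ i).Monic :=
    (monic_prod_of_monic _ _ fun j _ => monic_X_sub_C (θ j)).mul (monic_X_pow _)
  have hdegree (i : ℕ) : (τ i).degree = i := by
    have hcard : ((Finset.univ.filter fun j : Fin (d + 1) => j.val < i).card) = min (d + 1) i :=
      Fin.card_filter_val_lt
    rw [degree_mul, degree_prod, Finset.sum_congr rfl fun j _ => degree_X_sub_C (θ j),
      Finset.sum_const, hcard, degree_X_pow, nsmul_one]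
    norm_cast
    omega
  have hmem (i : ℕ) : τ i ∈ S := by
    rcases le_or_gt i d with hi | hi
    · convert hS ⟨i, Nat.lt_succ_of_le hi⟩ using 1
      simp only [τ]
      rw [Nat.sub_eq_zero_of_le (by omega), pow_zero, mul_one]
      congr 1
      ext j
      simp [Fin.lt_def]
    · refine hnodal _ (dvd_mul_of_dvd_left (dvd_of_eq ?_) _)
      rw [Lagrange.nodal_eq, Finset.filter_true_of_mem fun j _ => by omega]
  have hspan := Polynomial.Sequence.span (S := ⟨τ, hdegree⟩) fun i => (hmonic i).symm ▸ isUnit_one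
  exact Submodule.span_le.2 (Set.range_subset_iff.2 hmem) (hspan ▸ Submodule.mem_top)

variable {V : Type*} [AddCommGroup V] [Module K V] {V' : Type*} [AddCommGroup V'] [Module K V']

theorem IsTridiagonalOn.idem_apply_mem_span {A B : End K V} {θ : Fin (d + 1) → K}
    {θs : Fin (δ + 1) → K} (h : IsTridiagonalOn A B θ) (hs : IsTridiagonalOn B A θs) {z : V}
    (hz : idem B θs 0 z = z)
    (hτ : ∀ i, idem B θs 0 (aeval A (∏ j ∈ Finset.Iio i, (X - C (θ j))) z) ∈ K ∙ z) {w : V}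
    (hw : w ∈ cyclicSubmodule A B z) : idem B θs 0 w ∈ K ∙ z := by
  set e := idem B θs 0
  have happly (f : K[X]) : e (aeval A f z) ∈ K ∙ z := by
    refine mem_of_newton_mem
      (S := (K ∙ z).comap (e ∘ₗ LinearMap.applyₗ z ∘ₗ (aeval A).toLinearMap)) hτ ?_ f
    rintro _ ⟨g, rfl⟩
    have hA : aeval A (Lagrange.nodal Finset.univ θ * g) = 0 := by
      rw [map_mul, h.aeval_nodal, zero_mul]
    simp [hA]
  let S : Submodule K (End K V) := (K ∙ z).comap (LinearMap.applyₗ z)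
  have hS : S * S ≤ S := Submodule.mul_le.2 fun Y hY Z hZ => by
    obtain ⟨c, hc⟩ := Submodule.mem_span_singleton.1 hZ
    have hYZ : (Y * Z) z = c • Y z := by
      rw [End.mul_apply, ← map_smul, hc, LinearMap.applyₗ_apply_apply]
    rw [Submodule.mem_comap, LinearMap.applyₗ_apply_apply, hYZ]
    exact Submodule.smul_mem _ c hY
  obtain ⟨t, ht, rfl⟩ := mem_cyclicSubmodule.1 hw
  have hcorner (t : End K V) : e * t * e ∈ S ↔ e (t z) ∈ K ∙ z := by
    rw [Submodule.mem_comap, LinearMap.applyₗ_apply_apply, End.mul_apply, End.mul_apply, hz]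
  exact (hcorner t).1
    (h.corner_mem_of_mem_adjoin hs hS (fun f => (hcorner _).2 (happly f)) ht)

section ProdMap

variable {A B : End K V} {A' B' : End K V'}

theorem aeval_prodMap (f : K[X]) (A : End K V) (A' : End K V') :
    aeval (A.prodMap A') f = (aeval A f).prodMap (aeval A' f) := by
  have := aeval_algHom_apply (LinearMap.prodMapAlgHom K V V') (A, A') f
  rwa [aeval_prod_apply] at this

theorem idem_prodMap {ι : Type*} [Fintype ι] [DecidableEq ι] (A : End K V) (A' : End K V')
    (θ : ι → K) (i : ι) :
    idem (A.prodMap A') θ i = (idem A θ i).prodMap (idem A' θ i) :=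
  aeval_prodMap _ A A'

theorem IsTridiagonalOn.prodMap {θ : Fin (d + 1) → K} (h : IsTridiagonalOn A B θ)
    (h' : IsTridiagonalOn A' B' θ) : IsTridiagonalOn (A.prodMap A') (B.prodMap B') θ where
  injective := h.injective
  aeval_nodal := by rw [aeval_prodMap, h.aeval_nodal, h'.aeval_nodal, LinearMap.prodMap_zero]
  tri i j hij := by
    rw [idem_prodMap, idem_prodMap, LinearMap.prodMap_mul, LinearMap.prodMap_mul, h.tri i j hij,
      h'.tri i j hij, LinearMap.prodMap_zero]

section Intertwiners

variable {W : Type*} [AddCommGroup W] [Module K W] {C D : End K W} {N : Submodule K W}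

theorem ActsIrreducibly.map_eq_top (h : ActsIrreducibly A B) (hC : N.map C ≤ N)
    (hD : N.map D ≤ N) {T : W →ₗ[K] V} (hTC : T ∘ₗ C = A ∘ₗ T) (hTD : T ∘ₗ D = B ∘ₗ T) {w : W}
    (hw : w ∈ N) (hTw : T w ≠ 0) : N.map T = ⊤ := by
  refine (h _ ?_ ?_).resolve_left fun hbot => hTw ?_
  · rw [← Submodule.map_comp, ← hTC, Submodule.map_comp]
    exact Submodule.map_mono hC
  · rw [← Submodule.map_comp, ← hTD, Submodule.map_comp]
    exact Submodule.map_mono hD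
  · exact (Submodule.mem_bot K).1 (hbot ▸ Submodule.mem_map_of_mem hw)

theorem ActsIrreducibly.comap_eq_bot (h : ActsIrreducibly A B) (hC : N.map C ≤ N)
    (hD : N.map D ≤ N) {T : V →ₗ[K] W} (hTA : T ∘ₗ A = C ∘ₗ T) (hTB : T ∘ₗ B = D ∘ₗ T) {v : V}
    (hv : T v ∉ N) : N.comap T = ⊥ := by
  rw [Submodule.map_le_iff_le_comap] at hC hD
  refine (h _ ?_ ?_).resolve_right fun htop => hv ?_
  · rw [Submodule.map_le_iff_le_comap, ← Submodule.comap_comp, hTA, Submodule.comap_comp]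
    exact Submodule.comap_mono hC
  · rw [Submodule.map_le_iff_le_comap, ← Submodule.comap_comp, hTB, Submodule.comap_comp]
    exact Submodule.comap_mono hD
  · exact Submodule.mem_comap.1 (htop ▸ Submodule.mem_top)

end Intertwiners

theorem pairIsomorphic_of_invariant (h : ActsIrreducibly A B) (h' : ActsIrreducibly A' B')
    {N : Submodule K (V × V')} (hA : N.map (A.prodMap A') ≤ N) (hB : N.map (B.prodMap B') ≤ N)
    {v : V} {v' : V'} (hz : (v, v') ∈ N) (hv : (v, 0) ∉ N) (hv' : (0, v') ∉ N) :
    PairIsomorphic A B A' B' := by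
  have hv0 : v ≠ 0 := fun h0 => hv (h0 ▸ N.zero_mem)
  have hv0' : v' ≠ 0 := fun h0 => hv' (h0 ▸ N.zero_mem)
  have hfst : N.map (LinearMap.fst K V V') = ⊤ := h.map_eq_top hA hB rfl rfl hz hv0
  have hsnd : N.map (LinearMap.snd K V V') = ⊤ := h'.map_eq_top hA hB rfl rfl hz hv0'
  have hinl : N.comap (LinearMap.inl K V V') = ⊥ :=
    h.comap_eq_bot hA hB (by ext <;> simp) (by ext <;> simp) hv
  have hinr : N.comap (LinearMap.inr K V V') = ⊥ :=
    h'.comap_eq_bot hA hB (by ext <;> simp) (by ext <;> simp) hv'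
  obtain ⟨γ, hγ⟩ : ∃ γ : V ≃ₗ[K] V', N = γ.toLinearMap.graph := by
    refine Submodule.exists_equiv_eq_graph
      ⟨(injective_iff_map_eq_zero (LinearMap.fst K V V' ∘ₗ N.subtype)).2 ?_, fun x => ?_⟩
      ⟨(injective_iff_map_eq_zero (LinearMap.snd K V V' ∘ₗ N.subtype)).2 ?_, fun y => ?_⟩
    · rintro ⟨⟨x, y⟩, hxy⟩ (rfl : x = 0)
      have hy : y ∈ N.comap (LinearMap.inr K V V') := hxy
      rw [hinr, Submodule.mem_bot] at hy
      simp [hy]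
    · obtain ⟨w, hw, rfl⟩ := hfst ▸ Submodule.mem_top (x := x)
      exact ⟨⟨w, hw⟩, rfl⟩
    · rintro ⟨⟨x, y⟩, hxy⟩ (rfl : y = 0)
      have hx : x ∈ N.comap (LinearMap.inl K V V') := hxy
      rw [hinl, Submodule.mem_bot] at hx
      simp [hx]
    · obtain ⟨w, hw, rfl⟩ := hsnd ▸ Submodule.mem_top (x := y)
      exact ⟨⟨w, hw⟩, rfl⟩
  have hmem {x : V} {y : V'} : (x, y) ∈ N ↔ γ x = y := by
    rw [hγ, LinearMap.mem_graph_iff, eq_comm]; rfl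
  exact ⟨γ, fun x => hmem.1 (hA ⟨(x, γ x), hmem.2 rfl, rfl⟩),
    fun x => hmem.1 (hB ⟨(x, γ x), hmem.2 rfl, rfl⟩)⟩

end ProdMap

theorem IsStandardEigenvalues.pairIsomorphic {A B : End K V} {A' B' : End K V'}
    {θ : Fin (d + 1) → K} {θs : Fin (δ + 1) → K} (h : IsStandardEigenvalues A B θ)
    (hs : IsStandardEigenvalues B A θs) (hirr : ActsIrreducibly A B)
    (h' : IsStandardEigenvalues A' B' θ) (hs' : IsStandardEigenvalues B' A' θs)
    (hirr' : ActsIrreducibly A' B') {v : V} (hv : v ∈ B.eigenspace (θs 0)) (hv0 : v ≠ 0)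
    {v' : V'} (hv' : v' ∈ B'.eigenspace (θs 0)) (hv0' : v' ≠ 0)
    (hτ : ∀ i, ∃ c : K,
      idem B θs 0 (aeval A (∏ j ∈ Finset.Iio i, (X - C (θ j))) v) = c • v ∧
      idem B' θs 0 (aeval A' (∏ j ∈ Finset.Iio i, (X - C (θ j))) v') = c • v') :
    PairIsomorphic A B A' B' := by
  have hfix : idem B θs 0 v = v := by rw [hs.idem_apply_of_mem hv, if_pos rfl]
  have hfix' : idem B' θs 0 v' = v' := by rw [hs'.idem_apply_of_mem hv', if_pos rfl]
  have hline {w : V × V'} (hw : w ∈ cyclicSubmodule (A.prodMap A') (B.prodMap B') (v, v')) :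
      ∃ c : K, idem B θs 0 w.1 = c • v ∧ idem B' θs 0 w.2 = c • v' := by
    have hmem := (h.isTridiagonalOn.prodMap h'.isTridiagonalOn).idem_apply_mem_span
      (hs.isTridiagonalOn.prodMap hs'.isTridiagonalOn) (z := (v, v'))
      (by rw [idem_prodMap, LinearMap.prodMap_apply, hfix, hfix']) (fun i => ?_) hw
    · obtain ⟨c, hc⟩ := Submodule.mem_span_singleton.1 hmem
      rw [idem_prodMap, LinearMap.prodMap_apply, Prod.smul_mk, Prod.mk.injEq] at hc
      exact ⟨c, hc.1.symm, hc.2.symm⟩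
    · obtain ⟨c, hc, hc'⟩ := hτ i
      refine Submodule.mem_span_singleton.2 ⟨c, ?_⟩
      rw [idem_prodMap, aeval_prodMap, LinearMap.prodMap_apply, LinearMap.prodMap_apply, hc, hc',
        Prod.smul_mk]
  refine pairIsomorphic_of_invariant hirr hirr'
    (Submodule.map_le_iff_le_comap.2 fun _ => apply_mem_cyclicSubmodule (left_mem_adjoin _ _))
    (Submodule.map_le_iff_le_comap.2 fun _ => apply_mem_cyclicSubmodule (right_mem_adjoin _ _))
    (mem_cyclicSubmodule_self _ _ (v, v')) (fun hmem => ?_) fun hmem => ?_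
  · obtain ⟨c, hc, hc'⟩ := hline hmem
    rw [map_zero, eq_comm, smul_eq_zero_iff_left hv0'] at hc'
    exact hv0 (by rw [← hfix, hc, hc', zero_smul])
  · obtain ⟨c, hc, hc'⟩ := hline hmem
    rw [map_zero, eq_comm, smul_eq_zero_iff_left hv0] at hc
    exact hv0' (by rw [← hfix', hc', hc, zero_smul])

end Isomorphism

section Transport

variable {K : Type*} [Field K] {V : Type*} [AddCommGroup V] [Module K V]
  {V' : Type*} [AddCommGroup V'] [Module K V'] {d : ℕ} {A B : End K V} {A' B' : End K V'}
  {γ : V ≃ₗ[K] V'}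

theorem aeval_apply_of_intertwines (hA : ∀ v, γ (A v) = A' (γ v)) (f : K[X]) (v : V) :
    γ (aeval A f v) = aeval A' f (γ v) := by
  obtain rfl : A' = γ.conjAlgEquiv K A := LinearMap.ext fun w => by
    rw [LinearEquiv.conjAlgEquiv_apply_apply, hA, γ.apply_symm_apply]
  rw [aeval_algHom_apply, LinearEquiv.conjAlgEquiv_apply_apply, γ.symm_apply_apply]

theorem map_eigenspace (hA : ∀ v, γ (A v) = A' (γ v)) (μ : K) :
    (A.eigenspace μ).map (γ : V →ₗ[K] V') = A'.eigenspace μ := by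
  ext w
  obtain ⟨v, rfl⟩ := γ.surjective w
  rw [Submodule.mem_map_equiv, γ.symm_apply_apply, End.mem_eigenspace_iff, End.mem_eigenspace_iff,
    ← hA, ← map_smul, γ.injective.eq_iff]

theorem IsStandardOrdering.map {W : Fin (d + 1) → Submodule K V} (h : IsStandardOrdering A B W)
    (hA : ∀ v, γ (A v) = A' (γ v)) (hB : ∀ v, γ (B v) = B' (γ v)) :
    IsStandardOrdering A' B' fun i => (W i).map (γ : V →ₗ[K] V') where
  injective := (Submodule.map_injective_of_injective γ.injective).comp h.injective
  range_eq := by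
    refine (Set.range_comp (Submodule.map (γ : V →ₗ[K] V')) W).trans ?_
    rw [h.range_eq]
    ext U
    constructor
    · rintro ⟨_, ⟨hμ, μ, rfl⟩, rfl⟩
      exact ⟨fun hbot => hμ (Submodule.map_injective_of_injective γ.injective
        (hbot.trans (Submodule.map_bot _).symm)), μ, map_eigenspace hA μ⟩
    · rintro ⟨hμ, μ, rfl⟩
      refine ⟨A.eigenspace μ, ⟨fun hbot => hμ ?_, μ, rfl⟩, map_eigenspace hA μ⟩
      rw [← map_eigenspace hA, hbot, Submodule.map_bot]
  tridiagonal i := by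
    have hcomm : B' ∘ₗ (γ : V →ₗ[K] V') = (γ : V →ₗ[K] V') ∘ₗ B :=
      LinearMap.ext fun v => (hB v).symm
    rw [← Submodule.map_comp, hcomm, Submodule.map_comp]
    simpa only [Submodule.map_iSup] using
      Submodule.map_mono (f := (γ : V →ₗ[K] V')) (h.tridiagonal i)

theorem IsStandardIdempotents.map {E : Fin (d + 1) → End K V} (h : IsStandardIdempotents A B E)
    (hA : ∀ v, γ (A v) = A' (γ v)) (hB : ∀ v, γ (B v) = B' (γ v)) :
    IsStandardIdempotents A' B' fun i => γ.conj (E i) := by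
  obtain ⟨W, hW, hself, hne⟩ := h
  refine ⟨_, hW.map hA hB, ?_, ?_⟩
  · rintro i _ ⟨v, hv, rfl⟩
    rw [LinearEquiv.coe_coe, LinearEquiv.conj_apply_apply, γ.symm_apply_apply, hself i v hv]
  · rintro i j hij _ ⟨v, hv, rfl⟩
    rw [LinearEquiv.coe_coe, LinearEquiv.conj_apply_apply, γ.symm_apply_apply, hne i j hij v hv,
      map_zero]

theorem IsSharp.map (h : IsSharp A B) (hA : ∀ v, γ (A v) = A' (γ v))
    (hB : ∀ v, γ (B v) = B' (γ v)) : IsSharp A' B' := by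
  obtain ⟨d, ρ, ⟨W, Ws, hW, hWs, hρ⟩, hρ0⟩ := h
  exact ⟨d, ρ, ⟨_, _, hW.map hA hB, hWs.map hB hA, fun i =>
    ⟨(γ.finrank_map_eq (W i)).trans (hρ i).1, (γ.finrank_map_eq (Ws i)).trans (hρ i).2⟩⟩, hρ0⟩

theorem range_eq_map_range (hA : ∀ v, γ (A v) = A' (γ v)) :
    LinearMap.range A' = (LinearMap.range A).map (γ : V →ₗ[K] V') := by
  have hcomm : A' ∘ₗ (γ : V →ₗ[K] V') = (γ : V →ₗ[K] V') ∘ₗ A :=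
    LinearMap.ext fun v => (hA v).symm
  rw [← LinearMap.range_comp, ← hcomm, LinearMap.range_comp_of_range_eq_top _ γ.range]

namespace TridiagonalSystem

variable {Φ : TridiagonalSystem K V d}

theorem exists_isomorphic (Φ : TridiagonalSystem K V d) (hp : IsTridiagonalPair A' B')
    (hA : ∀ v, γ (Φ.A v) = A' (γ v)) (hB : ∀ v, γ (Φ.As v) = B' (γ v)) :
    ∃ Φ' : TridiagonalSystem K V' d, Φ'.A = A' ∧ Φ'.As = B' ∧ Φ.Isomorphic Φ' := by
  refine ⟨⟨A', fun i => γ.conj (Φ.E i), B', fun i => γ.conj (Φ.Es i), hp, Φ.standard.map hA hB,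
    Φ.standard_star.map hB hA⟩, rfl, rfl, rfl, γ, hA, hB, fun i j hij => ?_⟩
  obtain rfl := Fin.ext hij
  simp [LinearEquiv.conj_apply_apply]

theorem IsParameterArray.of_isomorphic {Φ' : TridiagonalSystem K V' d} {p : ParameterArray K d}
    (hp : Φ.IsParameterArray p) (h : Φ.Isomorphic Φ') : Φ'.IsParameterArray p := by
  obtain ⟨-, γ, hA, hAs, hE⟩ := h
  have hrange (i : Fin (d + 1)) := range_eq_map_range (hE i i rfl).1
  have hrange_star (i : Fin (d + 1)) := range_eq_map_range (hE i i rfl).2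
  have hsplit : Φ'.splitSpace 0 = (Φ.splitSpace 0).map (γ : V →ₗ[K] V') := by
    simp only [splitSpace, hrange, hrange_star, Submodule.map_inf _ γ.injective,
      Submodule.map_iSup]
  refine ⟨hp.sharp.map hA hAs, fun i => ?_, fun i => ?_, fun i => ?_⟩
  · rw [hrange, hp.eigenvalue, map_eigenspace hA]
  · rw [hrange_star, hp.eigenvalue_star, map_eigenspace hAs]
  · rw [hsplit]
    rintro _ ⟨u, hu, rfl⟩
    have hζ := congrArg γ (hp.split i u hu)
    rwa [upDown, End.mul_apply, aeval_apply_of_intertwines hAs, aeval_apply_of_intertwines hA,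
      map_smul] at hζ

end TridiagonalSystem

end Transport

section ParameterArrays

variable {K : Type*} [Field K]

theorem IsTridiagonalOn.aeval_prod_mul_aeval_mul_idem_zero {R : Type*} [Ring R] [Algebra K R]
    {d : ℕ} {a b : R} {θ : Fin (d + 1) → K} (h : IsTridiagonalOn a b θ) (i : Fin (d + 1))
    {f : K[X]} (hf : f.degree < (i + 1 : ℕ)) :
    aeval a (∏ j ∈ Finset.Ioc 0 i, (X - C (θ j))) * (aeval b f * idem a θ 0) =
      (∏ j ∈ Finset.Ioc 0 i, (θ 0 - θ j)) • (idem a θ 0 * (aeval b f * idem a θ 0)) := by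
  rw [← smul_mul_assoc, idem, ← map_smul, ← idem]
  refine h.aeval_mul_aeval_mul_idem_zero_congr hf fun j hj => ?_
  rw [eval_prod, eval_smul, smul_eq_mul]
  simp only [eval_sub, eval_X, eval_C]
  rcases eq_or_ne j 0 with rfl | hj0
  · rw [Lagrange.eval_basis_self h.injective.injOn (Finset.mem_univ _), mul_one]
  · rw [Lagrange.eval_basis_of_ne hj0.symm (Finset.mem_univ _), mul_zero]
    exact Finset.prod_eq_zero (Finset.mem_Ioc.2 ⟨Fin.pos_iff_ne_zero.2 hj0, hj⟩) (sub_self _)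

variable {V : Type*} [AddCommGroup V] [Module K V] {V' : Type*} [AddCommGroup V'] [Module K V']
  {d : ℕ} {A B : End K V} {A' B' : End K V'} {θ θs : Fin (d + 1) → K}

theorem IsStandardIdempotents.exists_eigenvalues {E : Fin (d + 1) → End K V}
    (hE : IsStandardIdempotents A B E) (hA : IsDiagonalizable A) :
    ∃ θ : Fin (d + 1) → K, IsStandardEigenvalues A B θ ∧ ∀ i, E i = idem A θ i := by
  obtain ⟨W, hW, hself, hne⟩ := hE
  obtain ⟨θ, hθ⟩ := hW.exists_eigenvalues
  have h := hW.isStandardEigenvalues hA hθ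
  refine ⟨θ, h, fun i => h.hom_ext fun j x hx => ?_⟩
  rw [h.idem_apply_of_mem hx]
  rw [← hθ] at hx
  split_ifs with hij
  · exact hself i x (hij ▸ hx)
  · exact hne i j (Ne.symm hij) x hx

namespace TridiagonalSystem

/-- `θ i` and `θs i` are the eigenvalues of `A` and `A^*` on `E i V` and `E^* i V`. -/
structure HasEigenvalues (Φ : TridiagonalSystem K V d) (θ θs : Fin (d + 1) → K) : Prop where
  left : IsStandardEigenvalues Φ.A Φ.As θ
  right : IsStandardEigenvalues Φ.As Φ.A θs
  E_eq : ∀ i, Φ.E i = idem Φ.A θ i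
  Es_eq : ∀ i, Φ.Es i = idem Φ.As θs i

variable {Φ : TridiagonalSystem K V d}

theorem exists_hasEigenvalues (Φ : TridiagonalSystem K V d) : ∃ θ θs, Φ.HasEigenvalues θ θs := by
  obtain ⟨θ, h, hE⟩ := Φ.standard.exists_eigenvalues Φ.isTridiagonalPair.diagonalizable_left
  obtain ⟨θs, hs, hEs⟩ :=
    Φ.standard_star.exists_eigenvalues Φ.isTridiagonalPair.diagonalizable_right
  exact ⟨θ, θs, h, hs, hE, hEs⟩

namespace HasEigenvalues

variable (h : Φ.HasEigenvalues θ θs)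
include h

theorem range_E (i : Fin (d + 1)) : LinearMap.range (Φ.E i) = Φ.A.eigenspace (θ i) := by
  rw [h.E_eq, h.left.isTridiagonalOn.range_idem]

theorem range_Es (i : Fin (d + 1)) : LinearMap.range (Φ.Es i) = Φ.As.eigenspace (θs i) := by
  rw [h.Es_eq, h.right.isTridiagonalOn.range_idem]

theorem splitSpace_zero : Φ.splitSpace 0 = Φ.As.eigenspace (θs 0) := by
  simp only [splitSpace, h.range_E, h.range_Es, Fin.le_zero_iff, iSup_iSup_eq_left, Fin.zero_le,
    iSup_pos, h.left.iSup_eq_top, inf_top_eq]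

theorem upDown_apply (i : Fin (d + 1)) {u : V} (hu : u ∈ Φ.As.eigenspace (θs 0)) :
    Φ.upDown θ θs i u = (∏ j ∈ Finset.Ioc 0 i, (θs 0 - θs j)) •
      idem Φ.As θs 0 (aeval Φ.A (∏ j ∈ Finset.Iio i, (X - C (θ j))) u) := by
  have hdeg : (∏ j ∈ Finset.Iio i, (X - C (θ j))).degree < ((i + 1 : ℕ) : WithBot ℕ) := by
    rw [degree_prod, Finset.sum_congr rfl fun j _ => degree_X_sub_C (θ j), Finset.sum_const,
      Fin.card_Iio, nsmul_one]
    exact_mod_cast Nat.lt_succ_self i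
  have hmul := LinearMap.congr_fun
    (h.right.isTridiagonalOn.aeval_prod_mul_aeval_mul_idem_zero i hdeg) u
  simpa only [upDown, End.mul_apply, LinearMap.smul_apply, h.right.idem_apply_of_mem hu, if_true]
    using hmul

theorem exists_isParameterArray (hrank : finrank K (Φ.As.eigenspace (θs 0)) = 1) :
    ∃ p, Φ.IsParameterArray p := by
  have hζ (i : Fin (d + 1)) : ∃ ζ : K, ∀ u ∈ Φ.As.eigenspace (θs 0),
      Φ.upDown θ θs i u = ζ • u := by
    have hmaps (u : V) (hu : u ∈ Φ.As.eigenspace (θs 0)) :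
        Φ.upDown θ θs i u ∈ Φ.As.eigenspace (θs 0) := by
      rw [h.upDown_apply i hu, ← h.right.isTridiagonalOn.range_idem 0]
      exact Submodule.smul_mem _ _ (LinearMap.mem_range_self _ _)
    obtain ⟨ζ, hζ, -⟩ := LinearMap.existsUnique_eq_smul_id_of_finrank_eq_one hrank
      ((Φ.upDown θ θs i).restrict hmaps)
    exact ⟨ζ, fun u hu => congrArg Subtype.val (LinearMap.congr_fun hζ ⟨u, hu⟩)⟩
  choose ζ hζ using hζ
  exact ⟨⟨θ, θs, ζ⟩,
    isSharp_of_finrank_eq_one h.left h.right Φ.isTridiagonalPair.irreducible hrank,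
    h.range_E, h.range_Es, fun i u hu => hζ i u (h.splitSpace_zero ▸ hu)⟩

end HasEigenvalues

theorem exists_isParameterArray [IsAlgClosed K] (Φ : TridiagonalSystem K V d) :
    ∃ p, Φ.IsParameterArray p := by
  obtain ⟨θ, θs, h⟩ := Φ.exists_hasEigenvalues
  exact h.exists_isParameterArray
    (h.left.finrank_eigenspace_zero h.right Φ.isTridiagonalPair.irreducible)

namespace IsParameterArray

variable {p : ParameterArray K d}

theorem hasEigenvalues (hp : Φ.IsParameterArray p) : Φ.HasEigenvalues p.θ p.θs := by
  obtain ⟨θ, θs, h⟩ := Φ.exists_hasEigenvalues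
  obtain rfl : θ = p.θ := funext fun i =>
    eq_of_eigenspace_eq ((h.range_E i).symm.trans (hp.eigenvalue i)) (h.left.ne_bot i)
  obtain rfl : θs = p.θs := funext fun i =>
    eq_of_eigenspace_eq ((h.range_Es i).symm.trans (hp.eigenvalue_star i)) (h.right.ne_bot i)
  exact h

theorem idem_zero_aeval_apply (hp : Φ.IsParameterArray p) (i : Fin (d + 1)) {u : V}
    (hu : u ∈ Φ.As.eigenspace (p.θs 0)) :
    idem Φ.As p.θs 0 (aeval Φ.A (∏ j ∈ Finset.Iio i, (X - C (p.θ j))) u) =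
      ((∏ j ∈ Finset.Ioc 0 i, (p.θs 0 - p.θs j))⁻¹ * p.ζ i) • u := by
  have h := hp.hasEigenvalues
  have hne : ∏ j ∈ Finset.Ioc 0 i, (p.θs 0 - p.θs j) ≠ 0 := Finset.prod_ne_zero_iff.2 fun j hj =>
    sub_ne_zero.2 (h.right.injective.ne (Finset.mem_Ioc.1 hj).1.ne)
  rw [mul_smul, ← hp.split i u (h.splitSpace_zero ▸ hu), h.upDown_apply i hu, inv_smul_smul₀ hne]

theorem isomorphic {Φ' : TridiagonalSystem K V' d} (hp : Φ.IsParameterArray p)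
    (hp' : Φ'.IsParameterArray p) : Φ.Isomorphic Φ' := by
  have h := hp.hasEigenvalues
  have h' := hp'.hasEigenvalues
  obtain ⟨v, hv, hv0⟩ := Submodule.exists_mem_ne_zero_of_ne_bot (h.right.ne_bot 0)
  obtain ⟨v', hv', hv0'⟩ := Submodule.exists_mem_ne_zero_of_ne_bot (h'.right.ne_bot 0)
  obtain ⟨γ, hA, hAs⟩ := h.left.pairIsomorphic h.right Φ.isTridiagonalPair.irreducible h'.left
    h'.right Φ'.isTridiagonalPair.irreducible hv hv0 hv' hv0' fun i =>
      ⟨_, hp.idem_zero_aeval_apply i hv, hp'.idem_zero_aeval_apply i hv'⟩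
  refine ⟨rfl, γ, hA, hAs, fun i j hij => ?_⟩
  obtain rfl := Fin.ext hij
  rw [h.E_eq, h.Es_eq, h'.E_eq, h'.Es_eq]
  exact ⟨aeval_apply_of_intertwines hA _, aeval_apply_of_intertwines hAs _⟩

end IsParameterArray

theorem isomorphic_iff [IsAlgClosed K] {d' : ℕ} (Φ : TridiagonalSystem K V d)
    (Φ' : TridiagonalSystem K V' d') : Φ.Isomorphic Φ' ↔ Φ.SameParameterArray Φ' := by
  constructor
  · intro hiso
    obtain ⟨p, hp⟩ := Φ.exists_isParameterArray
    obtain rfl := hiso.1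
    exact ⟨rfl, p, hp, hp.of_isomorphic hiso⟩
  · rintro ⟨rfl, p, hp, hp'⟩
    exact hp.isomorphic hp'

end TridiagonalSystem

theorem IsTridiagonalPair.exists_isPairParameterArray (hp : IsTridiagonalPair A B)
    (hsharp : IsSharp A B) : ∃ (d : ℕ) (p : ParameterArray K d), IsPairParameterArray A B p := by
  obtain ⟨d, ρ, ⟨W, Ws, hW, hWs, hρ⟩, hρ0⟩ := hsharp
  obtain ⟨θ, hθ⟩ := hW.exists_eigenvalues
  obtain ⟨θs, hθs⟩ := hWs.exists_eigenvalues
  have h := hW.isStandardEigenvalues hp.diagonalizable_left hθ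
  have hs := hWs.isStandardEigenvalues hp.diagonalizable_right hθs
  let Φ : TridiagonalSystem K V d := ⟨A, idem A θ, B, idem B θs, hp, h.isStandardIdempotents,
    hs.isStandardIdempotents⟩
  have hΦ : Φ.HasEigenvalues θ θs := ⟨h, hs, fun _ => rfl, fun _ => rfl⟩
  obtain ⟨p, hΦp⟩ := hΦ.exists_isParameterArray (hθs 0 ▸ (hρ 0).2.trans hρ0)
  exact ⟨d, p, Φ, rfl, rfl, hΦp⟩

theorem IsTridiagonalPair.isSharp [IsAlgClosed K] (hp : IsTridiagonalPair A B) : IsSharp A B := by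
  obtain ⟨d, W, hW⟩ := hp.exists_ordering_left
  obtain ⟨δ, Ws, hWs⟩ := hp.exists_ordering_right
  obtain ⟨θ, hθ⟩ := hW.exists_eigenvalues
  obtain ⟨θs, hθs⟩ := hWs.exists_eigenvalues
  have h := hW.isStandardEigenvalues hp.diagonalizable_left hθ
  have hs := hWs.isStandardEigenvalues hp.diagonalizable_right hθs
  obtain rfl := h.diameter_eq hs hp.irreducible
  exact isSharp_of_finrank_eq_one h hs hp.irreducible
    (h.finrank_eigenspace_zero hs hp.irreducible)

theorem pairIsomorphic_iff_of_isSharp (hp : IsTridiagonalPair A B)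
    (hp' : IsTridiagonalPair A' B') (hsharp : IsSharp A B) :
    PairIsomorphic A B A' B' ↔ HaveCommonParameterArray A B A' B' := by
  constructor
  · rintro ⟨γ, hA, hB⟩
    obtain ⟨d, p, Φ, rfl, rfl, hΦ⟩ := hp.exists_isPairParameterArray hsharp
    obtain ⟨Φ', hA', hB', hiso⟩ := Φ.exists_isomorphic hp' hA hB
    exact ⟨d, p, ⟨Φ, rfl, rfl, hΦ⟩, Φ', hA', hB', hΦ.of_isomorphic hiso⟩
  · rintro ⟨d, p, ⟨Φ, rfl, rfl, hΦ⟩, Φ', rfl, rfl, hΦ'⟩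
    obtain ⟨-, γ, hA, hAs, -⟩ := hΦ.isomorphic hΦ'
    exact ⟨γ, hA, hAs⟩

end ParameterArrays

end Tridiagonal

open Tridiagonal in
theorem theorem5p7_general (K : Type*) [Field K] (V : Type*) [AddCommGroup V] [Module K V]
    (V' : Type*) [AddCommGroup V'] [Module K V'] :
    (∀ (A As : End K V) (A' As' : End K V'),
      IsTridiagonalPair A As → IsTridiagonalPair A' As' → IsSharp A As →
      (PairIsomorphic A As A' As' ↔ HaveCommonParameterArray A As A' As')) ∧
    (IsAlgClosed K →
      (∀ (A As : End K V) (A' As' : End K V'),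
        IsTridiagonalPair A As → IsTridiagonalPair A' As' →
        (PairIsomorphic A As A' As' ↔ HaveCommonParameterArray A As A' As')) ∧
      (∀ (d d' : ℕ) (Φ : TridiagonalSystem K V d) (Φ' : TridiagonalSystem K V' d'),
        Φ.Isomorphic Φ' ↔ Φ.SameParameterArray Φ')) :=
  ⟨fun _ _ _ _ => pairIsomorphic_iff_of_isSharp, fun _ =>
    ⟨fun _ _ _ _ hp hp' => pairIsomorphic_iff_of_isSharp hp hp' hp.isSharp,
      fun _ _ Φ Φ' => Φ.isomorphic_iff Φ'⟩⟩

theorem theorem5p7 (K : Type*) [Field K]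
    (V : Type*) [AddCommGroup V] [Module K V] [FiniteDimensional K V] [Nontrivial V]
    (V' : Type*) [AddCommGroup V'] [Module K V'] [FiniteDimensional K V'] [Nontrivial V'] :
    (∀ (A As : Module.End K V) (A' As' : Module.End K V'),
      Tridiagonal.IsTridiagonalPair A As → Tridiagonal.IsTridiagonalPair A' As' →
      Tridiagonal.IsSharp A As → Tridiagonal.IsSharp A' As' →
      (Tridiagonal.PairIsomorphic A As A' As' ↔
        Tridiagonal.HaveCommonParameterArray A As A' As')) ∧
    (IsAlgClosed K →
      (∀ (A As : Module.End K V) (A' As' : Module.End K V'),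
        Tridiagonal.IsTridiagonalPair A As → Tridiagonal.IsTridiagonalPair A' As' →
        (Tridiagonal.PairIsomorphic A As A' As' ↔
          Tridiagonal.HaveCommonParameterArray A As A' As')) ∧
      (∀ (d d' : ℕ) (Φ : Tridiagonal.TridiagonalSystem K V d)
        (Φ' : Tridiagonal.TridiagonalSystem K V' d'),
        Φ.Isomorphic Φ' ↔ Φ.SameParameterArray Φ')) := by
  obtain ⟨hsharp, hclosed⟩ := theorem5p7_general K V V'
  exact ⟨fun A As A' As' hp hp' hs _ => hsharp A As A' As' hp hp' hs, hclosed⟩
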